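/- Let $d\ge 0$, $0<r,R<\infty$. An $(r,R)$-set is a set $\omega\subset\mathbb R^d$ such that $\|x-y\|\ge r$ for distinct $x,y\in\omega$ and every closed ball of radius $R$ meets $\omega$. The natural topology on the closed subsets of $\mathbb R^d$ has the neighbourhood bases $\{G: d_k(F,G)\le\varepsilon\}$, $\varepsilon>0$, $k\in\mathbb N$, where $d_k(F,G)=\inf(\{\varepsilon>0: F\cap B_k\subset U_\varepsilon(G),\ G\cap B_k\subset U_\varepsilon(F)\}\cup\{1\})$, with $B_k$ the closed ball of radius $k$ about $0$ and $U_\varepsilon$ the open $\varepsilon$-neighbourhood. Let $\Omega$ be a translation invariant set of $(r,R)$-sets which is closed in the natural topology, and let $\mu$ be a finite translation invariant Borel measure on $\Omega$. Put $\mathcal X=\{(\omega,x):\omega\in\Omega,\ x\in\omega\}\subset\Omega\times\mathbb R^d$, with its Borel $\sigma$-algebra. A family $(g_\omega)_{\omega\in\Omega}$ with $g_\omega\in\ell^2(\omega)$ is called a measurable section if $(\omega,x)\mapsto g_\omega(x)$ is measurable on $\mathcal X$. Let $\mathcal N$ be the $*$-algebra of families $A=(A_\omega)_{\omega\in\Omega}$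 of bounded operators $A_\omega$ on $\ell^2(\omega)$ which are covariant ($A_{\omega+t}=U_tA_\omega U_t^*$ for all $\omega\in\Omega$ and $t\in\mathbb R^d$, where $U_t:\ell^2(\omega)\to\ell^2(\omega+t)$ is induced by translation), measurable ($\omega\mapsto\langle f_\omega,A_\omega g_\omega\rangle$ is measurable for all measurable sections $f,g$) and bounded ($\sup_\omega\|A_\omega\|<\infty$), where families that agree $\mu$-almost everywhere are identified. Its norm is $\|A\|=\operatorname{ess\,sup}_\omega\|A_\omega\|$; it acts fibrewise on the direct integral $\int^\oplus_\Omega\ell^2(\omega)\,d\mu(\omega)$ of square integrable measurable sections. Let $\mathcal N^+$ be the set of $A\in\mathcal N$ with $A_\omega\ge0$ for $\mu$-a.e. $\omega$. For $f\in C_c(\mathbb R^d)$, $f\ge 0$, $\int f\,dx=1$, let $M_f$ be multiplication by $f$ on $\ell^2(\omega)$. (1) For $A\in\mathcal N$ the function $\omega\mapsto\operatorname{tr}(A_\omega M_f)$ is $\mu$-integrable and $$\tau(A)=\int_\Omega\operatorname{tr}(A_\omega M_f)\,d\mu(\omega)$$ does not depend on the choice of such an $f$. (2) The map $\tau:\mathcal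 N\to\mathbb C$ is linear, continuous (for the norm, and also for the weak operator topology of the action on $\int^\oplus_\Omega\ell^2(\omega)\,d\mu(\omega)$), nonnegative on $\mathcal N^+$, faithful (if $A\in\mathcal N^+$ and $\tau(A)=0$, then $A=0$), and $\tau(AB)=\tau(BA)$ for all $A,B\in\mathcal N$. (3) Let $A\in\mathcal N$ be selfadjoint. For every bounded Borel function $F:\mathbb R\to\mathbb C$ the operators $F(A_\omega)$ define a unique element $F(A)$ of $\mathcal N$. There is a finite Borel measure $\rho_A$ on $\mathbb R$ with $\rho_A(B)=\tau(\chi_B(A))$ for all Borel sets $B$; it is a spectral measure for $A$, that is, $\rho_A(B)=0$ if and only if $\chi_B(A)=0$; and $\int F\,d\rho_A=\tau(F(A))$ for every bounded Borel function $F$. If $\mu\ne0$ and $\sigma(A_\omega)=\Sigma$ for $\mu$-a.e. $\omega$, then $\operatorname{supp}\rho_A=\Sigma$. If $\mu$ is ergodic, then $\sigma(A_\omega)=\operatorname{supp}\rho_A$ for $\mu$-a.e. $\omega$. -/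

import Mathlib

open MeasureTheory Filter Topology Set
open scoped ENNReal InnerProductSpace CompactlySupported

noncomputable section
namespace Delone

abbrev Space (d : ℕ) : Type := EuclideanSpace ℝ (Fin d)

/-- The set of closed subsets of `ℝ^d`. -/
@[ext]
structure ClosedSubset (d : ℕ) : Type where
  carrier : Set (Space d)
  isClosed_carrier : IsClosed carrier

namespace ClosedSubset
variable {d : ℕ}

instance : SetLike (ClosedSubset d) (Space d) where
  coe := carrier
  coe_injective := fun F G h => by cases F; cases G; congr

/-- The distance `d_k` of the parts in the closed ball of radius `k`. -/
def localDist (k : ℕ) (F G : ClosedSubset d) : ℝ :=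
  sInf ({ε : ℝ | 0 < ε ∧ (F : Set (Space d)) ∩ Metric.closedBall 0 k ⊆ Metric.thickening ε G ∧
    (G : Set (Space d)) ∩ Metric.closedBall 0 k ⊆ Metric.thickening ε F} ∪ {1})

theorem localDist_mono {k l : ℕ} (h : k ≤ l) (F G : ClosedSubset d) :
    localDist k F G ≤ localDist l F G := by
  have hb : Metric.closedBall (0 : Space d) k ⊆ Metric.closedBall 0 l :=
    Metric.closedBall_subset_closedBall (by exact_mod_cast h)
  refine csInf_le_csInf ⟨0, ?_⟩ ⟨1, Or.inr rfl⟩ ?_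
  · rintro ε (hε | rfl)
    · exact hε.1.le
    · exact zero_le_one
  · refine union_subset_union_left _ ?_
    rintro ε ⟨h0, h1, h2⟩
    exact ⟨h0, (inter_subset_inter_right _ hb).trans h1, (inter_subset_inter_right _ hb).trans h2⟩

/-- The natural topology: the sets `{G | d_k(F, G) ≤ ε}`, `ε > 0`, `k ∈ ℕ`, form a basis of
neighbourhoods of `F`. -/
instance : TopologicalSpace (ClosedSubset d) where
  IsOpen V := ∀ F ∈ V, ∃ ε : ℝ, 0 < ε ∧ ∃ k : ℕ, ∀ G, localDist k F G ≤ ε → G ∈ V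
  isOpen_univ := fun _ _ => ⟨1, one_pos, 0, fun _ _ => trivial⟩
  isOpen_inter := by
    rintro V W hV hW F ⟨hFV, hFW⟩
    obtain ⟨ε, hε, k, h⟩ := hV F hFV
    obtain ⟨δ, hδ, l, h'⟩ := hW F hFW
    refine ⟨min ε δ, lt_min hε hδ, max k l, fun G hG => ⟨h G ?_, h' G ?_⟩⟩
    · exact (localDist_mono (le_max_left _ _) F G).trans (hG.trans (min_le_left _ _))
    · exact (localDist_mono (le_max_right _ _) F G).trans (hG.trans (min_le_right _ _))
  isOpen_sUnion := by
    rintro S hS F ⟨V, hV, hF⟩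
    obtain ⟨ε, hε, k, h⟩ := hS V hV F hF
    exact ⟨ε, hε, k, fun G hG => ⟨V, hV, h G hG⟩⟩

/-- The translation action `t +ᵥ F = F + t`. -/
instance : AddAction (Space d) (ClosedSubset d) where
  vadd t F := ⟨{x | x - t ∈ F}, F.isClosed_carrier.preimage (continuous_id.sub continuous_const)⟩
  zero_vadd F := by
    ext x
    change x - 0 ∈ F ↔ x ∈ F
    rw [sub_zero]
  add_vadd s t F := by
    ext x
    change x - (s + t) ∈ F ↔ x - s - t ∈ F
    rw [sub_sub]

theorem mem_vadd {t x : Space d} {F : ClosedSubset d} : x ∈ t +ᵥ F ↔ x - t ∈ F := Iff.rfl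

theorem isOpen_setOf_hit (x : Space d) (ρ : ℝ) :
    IsOpen {G : ClosedSubset d | ∃ y ∈ G, dist y x < ρ} := by
  rintro F ⟨y, hyF, hy⟩
  obtain ⟨k, hk⟩ := exists_nat_ge ‖y‖
  have hpos : 0 < min (ρ - dist y x) 1 := lt_min (by linarith) one_pos
  refine ⟨min (ρ - dist y x) 1 / 2, by linarith, k, fun G hG => ?_⟩
  obtain ⟨ε, hε, hlt⟩ := exists_lt_of_csInf_lt (⟨1, Or.inr rfl⟩ :
    ({ε : ℝ | 0 < ε ∧ (F : Set (Space d)) ∩ Metric.closedBall 0 k ⊆ Metric.thickening ε G ∧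
    (G : Set (Space d)) ∩ Metric.closedBall 0 k ⊆ Metric.thickening ε F} ∪ {1}).Nonempty)
    (lt_of_le_of_lt hG (half_lt_self hpos))
  rcases hε with ⟨-, h, -⟩ | rfl
  · have := h ⟨hyF, by simpa using hk⟩
    obtain ⟨z, hz, hyz⟩ := Metric.mem_thickening_iff.1 this
    refine ⟨z, hz, ?_⟩
    have := min_le_left (ρ - dist y x) 1
    have := dist_triangle z y x
    rw [dist_comm z y] at this
    linarith
  · exact absurd (min_le_right (ρ - dist y x) 1) (not_le.2 hlt)

/-- `ω` is an `(r,R)`-set. -/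
structure IsDeloneSet (r R : ℝ) (ω : ClosedSubset d) : Prop where
  le_dist : ∀ x ∈ ω, ∀ y ∈ ω, x ≠ y → r ≤ dist x y
  hit : ∀ x : Space d, (Metric.closedBall x R ∩ (ω : Set (Space d))).Nonempty

end ClosedSubset

/-- A Delone dynamical system which is an `(r,R)`-system: a translation invariant set of
`(r,R)`-sets, closed in the natural topology. -/
structure DeloneSystem (d : ℕ) (r R : ℝ) where
  r_pos : 0 < r
  R_pos : 0 < R
  carrier : Set (ClosedSubset d)
  isClosed_carrier : IsClosed carrier
  vadd_mem : ∀ (t : Space d), ∀ ω ∈ carrier, t +ᵥ ω ∈ carrier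
  isDeloneSet : ∀ ω ∈ carrier, ω.IsDeloneSet r R

/-- `ℓ²(ω)`, with the counting measure on `ω`. -/
abbrev Ell2 {d : ℕ} (ω : ClosedSubset d) : Type := lp (fun _ : ω => ℂ) 2

section Ell2
variable {d : ℕ}

theorem memℓp_two_iff {ι : Type*} (g : ι → ℂ) : Memℓp g 2 ↔ Summable fun i => ‖g i‖ ^ 2 := by
  rw [memℓp_gen_iff (by norm_num)]
  norm_num

theorem norm_sq_eq_tsum {ι : Type*} (g : lp (fun _ : ι => ℂ) 2) :
    ‖g‖ ^ 2 = ∑' i, ‖g i‖ ^ 2 := by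
  have := lp.norm_rpow_eq_tsum (p := 2) (by norm_num) g
  norm_num at this
  exact this

/-- The bijection `x ↦ x + t` from `ω` to `ω + t`. -/
def shiftEquiv (t : Space d) (ω : ClosedSubset d) : ω ≃ (t +ᵥ ω : ClosedSubset d) where
  toFun x := ⟨x + t, by rw [ClosedSubset.mem_vadd, add_sub_cancel_right]; exact x.2⟩
  invFun y := ⟨y - t, y.2⟩
  left_inv x := by simp
  right_inv y := by simp

/-- The unitary `U_t : ℓ²(ω) → ℓ²(ω + t)`, `(U_t g)(y) = g(y - t)`. -/
def shiftUnitary (t : Space d) (ω : ClosedSubset d) : Ell2 ω ≃ₗᵢ[ℂ] Ell2 (t +ᵥ ω) where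
  toFun g := ⟨fun y => g ((shiftEquiv t ω).symm y), (memℓp_two_iff _).2
    (((shiftEquiv t ω).symm.summable_iff (f := fun x => ‖g x‖ ^ 2)).2 ((memℓp_two_iff _).1 g.2))⟩
  invFun h := ⟨fun x => h (shiftEquiv t ω x), (memℓp_two_iff _).2
    (((shiftEquiv t ω).summable_iff (f := fun x => ‖h x‖ ^ 2)).2 ((memℓp_two_iff _).1 h.2))⟩
  map_add' g h := by ext; rfl
  map_smul' c g := by ext; rfl
  left_inv g := by ext x; simp
  right_inv h := by ext x; simp
  norm_map' g := by
    rw [← sq_eq_sq₀ (norm_nonneg _) (norm_nonneg _), norm_sq_eq_tsum, norm_sq_eq_tsum]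
    exact (shiftEquiv t ω).symm.tsum_eq (fun x => ‖g x‖ ^ 2)

theorem memℓp_mul (f : C_c(Space d, ℝ)) {ω : ClosedSubset d} (g : Ell2 ω) :
    Memℓp (fun x : ω => (f (x : Space d) : ℂ) * g x) 2 := by
  obtain ⟨K, hK⟩ := f.hasCompactSupport.exists_bound_of_continuous f.continuous
  refine (memℓp_two_iff _).2 (Summable.of_nonneg_of_le (fun _ => by positivity) (fun x => ?_)
    (((memℓp_two_iff _).1 g.2).mul_left (K ^ 2)))
  rw [norm_mul, mul_pow, Complex.norm_real]
  gcongr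
  exact hK x

/-- The operator `M_f` of multiplication by the restriction of `f ∈ C_c(ℝ^d)` to `ω`. -/
def mulOp (f : C_c(Space d, ℝ)) (ω : ClosedSubset d) : Ell2 ω →L[ℂ] Ell2 ω :=
  LinearMap.mkContinuousOfExistsBound
    { toFun := fun g => ⟨fun x => (f (x : Space d) : ℂ) * g x, memℓp_mul f g⟩
      map_add' := fun g h => by ext x; exact mul_add _ _ _
      map_smul' := fun c g => by ext x; exact mul_left_comm _ _ _ }
    (by
      obtain ⟨K, hK⟩ := f.hasCompactSupport.exists_bound_of_continuous f.continuous
      have h0 : 0 ≤ K := (norm_nonneg _).trans (hK 0)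
      refine ⟨K, fun g => (sq_le_sq₀ (norm_nonneg _) (by positivity)).1 ?_⟩
      rw [mul_pow, norm_sq_eq_tsum, norm_sq_eq_tsum, ← tsum_mul_left]
      refine Summable.tsum_le_tsum (fun x => ?_) ((memℓp_two_iff _).1 (memℓp_mul f g))
        (((memℓp_two_iff _).1 g.2).mul_left _)
      change ‖(f (x : Space d) : ℂ) * g x‖ ^ 2 ≤ _
      rw [norm_mul, mul_pow, Complex.norm_real]
      gcongr
      exact hK x)

theorem mulOp_apply (f : C_c(Space d, ℝ)) {ω : ClosedSubset d} (g : Ell2 ω) (x : ω) :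
    mulOp f ω g x = f (x : Space d) * g x := rfl

open Classical in
/-- The trace of an operator on `ℓ²(ω)`, computed in the orthonormal basis of unit masses. -/
def tr {ω : ClosedSubset d} (T : Ell2 ω →L[ℂ] Ell2 ω) : ℂ :=
  ∑' x : ω, ⟪lp.single 2 x (1 : ℂ), T (lp.single 2 x (1 : ℂ))⟫_ℂ

end Ell2

instance (d : ℕ) : MeasurableSpace (ClosedSubset d) := borel _

instance (d : ℕ) : BorelSpace (ClosedSubset d) := ⟨rfl⟩

namespace DeloneSystem
variable {d : ℕ} {r R : ℝ} (Ω : DeloneSystem d r R)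

/-- The points of the dynamical system, with the subspace topology and its Borel `σ`-algebra. -/
abbrev Pt : Type := {ω : ClosedSubset d // ω ∈ Ω.carrier}

instance : AddAction (Space d) Ω.Pt where
  vadd t ω := ⟨t +ᵥ ω.1, Ω.vadd_mem t ω.1 ω.2⟩
  zero_vadd ω := Subtype.ext (zero_vadd _ ω.1)
  add_vadd s t ω := Subtype.ext (add_vadd s t ω.1)

/-- The bundle `𝒳 = {(ω, x) : x ∈ ω}`, with the subspace topology of `Ω × ℝ^d` and its Borel
`σ`-algebra. -/
abbrev Bundle : Type := {p : Ω.Pt × Space d // p.2 ∈ p.1.1}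

/-- Families `(f_ω)` with `f_ω ∈ ℓ²(ω)`. -/
abbrev Section : Type := ∀ ω : Ω.Pt, Ell2 ω.1

/-- Measurability of a family `(f_ω)`, regarded as a function on `𝒳`. -/
def MeasurableSection (f : Ω.Section) : Prop :=
  Measurable fun p : Ω.Bundle => f p.1.1 ⟨p.1.2, p.2⟩

/-- Families `(A_ω)` of bounded operators `A_ω` on `ℓ²(ω)`, with pointwise operations. -/
abbrev OpFamily : Type := ∀ ω : Ω.Pt, Ell2 ω.1 →L[ℂ] Ell2 ω.1

variable {Ω}

/-- Covariance, `A_{ω+t} = U_t A_ω U_t^*`. -/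
def Covariant (A : Ω.OpFamily) : Prop :=
  ∀ (t : Space d) (ω : Ω.Pt),
    A (t +ᵥ ω) = ((shiftUnitary t ω.1 : Ell2 ω.1 →L[ℂ] Ell2 (t +ᵥ ω.1)) ∘L A ω) ∘L
      ((shiftUnitary t ω.1).symm : Ell2 (t +ᵥ ω.1) →L[ℂ] Ell2 ω.1)

def MeasurableFamily (A : Ω.OpFamily) : Prop :=
  ∀ f g : Ω.Section, Ω.MeasurableSection f → Ω.MeasurableSection g →
    Measurable fun ω => ⟪f ω, A ω (g ω)⟫_ℂ

def BoundedFamily (A : Ω.OpFamily) : Prop :=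
  ∃ K : ℝ, ∀ ω, ‖A ω‖ ≤ K

theorem eq_of_dist_lt {ω : ClosedSubset d} (h : ω.IsDeloneSet r R) {q x y : Space d} (hx : x ∈ ω)
    (hy : y ∈ ω) (hxq : dist x q < r / 2) (hyq : dist y q < r / 2) : x = y := by
  by_contra hne
  have := h.le_dist x hx y hy hne
  have := dist_triangle_right x y q
  linarith

open Classical in
/-- The unit mass at the point of `ω` near `q`, if there is one. -/
def localUnit (Ω : DeloneSystem d r R) (q : Space d) : Ω.Section := fun ω =>
  if h : ∃ y ∈ ω.1, dist y q < r / 2 then lp.single 2 ⟨h.choose, h.choose_spec.1⟩ (1 : ℂ) else 0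

theorem localUnit_eq (q : Space d) {ω : Ω.Pt} {x : Space d} (hx : x ∈ ω.1)
    (hxq : dist x q < r / 2) : 
    localUnit Ω q ω = lp.single 2 (⟨x, hx⟩ : ω.1) (1 : ℂ) := by
  have h : ∃ y ∈ ω.1, dist y q < r / 2 := ⟨x, hx, hxq⟩
  have : h.choose = x := eq_of_dist_lt (Ω.isDeloneSet _ ω.2) h.choose_spec.1 hx h.choose_spec.2 hxq
  rw [localUnit, dif_pos h]
  congr!

theorem localUnit_apply (q : Space d) (p : Ω.Bundle) :
    localUnit Ω q p.1.1 ⟨p.1.2, p.2⟩ = if dist p.1.2 q < r / 2 then 1 else 0 := by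
  split_ifs with h
  · rw [localUnit_eq q p.2 h]
    simp
  · rw [localUnit]
    split_ifs with h'
    · rw [lp.single_apply_ne]
      rintro heq
      apply h
      have := congrArg Subtype.val heq
      simp only at this
      rw [this]
      exact h'.choose_spec.2
    · rfl

theorem measurableSection_localUnit (q : Space d) : Ω.MeasurableSection (localUnit Ω q) := by
  unfold MeasurableSection
  simp_rw [localUnit_apply]
  refine Measurable.ite ?_ measurable_const measurable_const
  exact measurableSet_lt (by fun_prop) measurable_const

theorem inner_localUnit (q : Space d) (f : Ω.Section) (p : Ω.Bundle) (h : dist p.1.2 q < r / 2) :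
    ⟪localUnit Ω q p.1.1, f p.1.1⟫_ℂ = f p.1.1 ⟨p.1.2, p.2⟩ := by
  rw [localUnit_eq q p.2 h, lp.inner_single_left]
  simp

/-- A family is a measurable section as soon as its inner products with measurable sections are
measurable. -/
theorem measurableSection_of_inner {f : Ω.Section}
    (h : ∀ g, Ω.MeasurableSection g → Measurable fun ω => ⟪g ω, f ω⟫_ℂ) :
    Ω.MeasurableSection f := by
  have hr := Ω.r_pos
  let q := TopologicalSpace.denseSeq (Space d)
  let S : ℕ → Set Ω.Bundle := fun n => {p | dist p.1.2 (q n) < r / 2}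
  have hS : ∀ n, MeasurableSet (S n) := fun n =>
    measurableSet_lt (by fun_prop) measurable_const
  have hU : ⋃ n, S n = univ := by
    refine eq_univ_of_forall fun p => mem_iUnion.2 ?_
    obtain ⟨n, hn⟩ := (TopologicalSpace.denseRange_denseSeq (Space d)).exists_dist_lt p.1.2
      (half_pos hr)
    exact ⟨n, hn⟩
  have hpre : ∀ s : Set ℂ, (fun p : Ω.Bundle => f p.1.1 ⟨p.1.2, p.2⟩) ⁻¹' s =
      ⋃ n, S n ∩ (fun p : Ω.Bundle => ⟪localUnit Ω (q n) p.1.1, f p.1.1⟫_ℂ) ⁻¹' s := by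
    intro s
    ext p
    simp only [mem_preimage, mem_iUnion, mem_inter_iff]
    constructor
    · intro hp
      obtain ⟨n, hn⟩ := mem_iUnion.1 (hU.symm ▸ mem_univ p)
      exact ⟨n, hn, by rwa [inner_localUnit (q n) f p hn]⟩
    · rintro ⟨n, hn, hp⟩
      rwa [inner_localUnit (q n) f p hn] at hp
  intro s hs
  rw [hpre]
  refine MeasurableSet.iUnion fun n => (hS n).inter ?_
  exact ((h _ (measurableSection_localUnit (q n))).comp
    (measurable_fst.comp measurable_subtype_coe)) hs

theorem isOpen_hit {U : Set (Space d)} (hU : IsOpen U) :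
    IsOpen {ω : Ω.Pt | ∃ y ∈ ω.1, y ∈ U} := by
  have : {ω : Ω.Pt | ∃ y ∈ ω.1, y ∈ U} = ⋃ (x : Space d) (ρ : ℝ) (_ : Metric.ball x ρ ⊆ U),
      Subtype.val ⁻¹' {G : ClosedSubset d | ∃ y ∈ G, dist y x < ρ} := by
    ext ω
    simp only [mem_ofPred_eq, mem_iUnion, mem_preimage]
    constructor
    · rintro ⟨y, hy, hyU⟩
      obtain ⟨ε, hε, h⟩ := Metric.isOpen_iff.1 hU y hyU
      exact ⟨y, ε, h, y, hy, by simpa using hε⟩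
    · rintro ⟨x, ρ, h, y, hy, hyx⟩
      exact ⟨y, hy, h hyx⟩
  rw [this]
  exact isOpen_iUnion fun x => isOpen_iUnion fun ρ => isOpen_iUnion fun _ =>
    (ClosedSubset.isOpen_setOf_hit x ρ).preimage continuous_subtype_val

open Classical in
/-- The value of a function on `𝒳` at the point of `ω` near `q`, if there is one. -/
def localEval (q : Space d) (F : Ω.Bundle → ℂ) (ω : Ω.Pt) : ℂ :=
  if h : ∃ y ∈ ω.1, dist y q < r / 2 then F ⟨(ω, h.choose), h.choose_spec.1⟩ else 0

theorem localEval_eq {q : Space d} (F : Ω.Bundle → ℂ) {ω : Ω.Pt} (x : ω.1)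
    (hx : dist (x : Space d) q < r / 2) : localEval q F ω = F ⟨(ω, x), x.2⟩ := by
  have h : ∃ y ∈ ω.1, dist y q < r / 2 := ⟨x, x.2, hx⟩
  have h' : (⟨h.choose, h.choose_spec.1⟩ : ω.1) = x := Subtype.ext
    (eq_of_dist_lt (Ω.isDeloneSet _ ω.2) h.choose_spec.1 x.2 h.choose_spec.2 hx)
  rw [localEval, dif_pos h]
  exact congrArg (fun z : ω.1 => F ⟨(ω, z), z.2⟩) h'

theorem localEval_eq_zero {q : Space d} {F : Ω.Bundle → ℂ} {ω : Ω.Pt}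
    (h : ∀ x : ω.1, dist (x : Space d) q < r / 2 → F ⟨(ω, x), x.2⟩ = 0) :
    localEval q F ω = 0 := by
  rw [localEval]
  split_ifs with h'
  · exact h ⟨_, h'.choose_spec.1⟩ h'.choose_spec.2
  · rfl

theorem measurable_localEval (q : Space d) {F : Ω.Bundle → ℂ} (hF : Measurable F) :
    Measurable (localEval q F) := by
  classical
  let H : Set Ω.Pt := {ω | ∃ y ∈ ω.1, dist y q < r / 2}
  have hH : MeasurableSet H := (isOpen_hit (Metric.isOpen_ball (x := q) (ε := r / 2))).measurableSet
  have hs : Measurable fun ω : H => (ω.2.choose : Space d) := by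
    refine measurable_of_isOpen fun U hU => ?_
    have : (fun ω : H => (ω.2.choose : Space d)) ⁻¹' U =
        Subtype.val ⁻¹' {ω : Ω.Pt | ∃ y ∈ ω.1, y ∈ U ∩ Metric.ball q (r / 2)} := by
      ext ω
      constructor
      · intro h
        exact ⟨_, ω.2.choose_spec.1, h, ω.2.choose_spec.2⟩
      · rintro ⟨y, hy, hyU, hyq⟩
        have := eq_of_dist_lt (Ω.isDeloneSet _ ω.1.2) ω.2.choose_spec.1 hy ω.2.choose_spec.2 hyq
        change ω.2.choose ∈ U
        rwa [this]
    rw [this]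
    exact measurable_subtype_coe (isOpen_hit (hU.inter Metric.isOpen_ball)).measurableSet
  refine Measurable.dite (s := H) (f := fun ω : H => F ⟨(ω.1, ω.2.choose), ω.2.choose_spec.1⟩)
    (g := fun _ => 0) ?_ measurable_const hH
  exact hF.comp ((measurable_subtype_coe.prodMk hs).subtype_mk)

theorem measurable_tsum_bundle {F : Ω.Bundle → ℂ} (hF : Measurable F)
    (hs : ∀ ω : Ω.Pt, Summable fun x : ω.1 => F ⟨(ω, x), x.2⟩) :
    Measurable fun ω : Ω.Pt => ∑' x : ω.1, F ⟨(ω, x), x.2⟩ := by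
  classical
  have hr := Ω.r_pos
  let q := TopologicalSpace.denseSeq (Space d)
  have hq : ∀ x : Space d, ∃ n, dist x (q n) < r / 2 := fun x =>
    (TopologicalSpace.denseRange_denseSeq (Space d)).exists_dist_lt x (half_pos hr)
  obtain ⟨N, hN, hNq⟩ : ∃ N : Space d → ℕ, Measurable N ∧ ∀ x, dist x (q (N x)) < r / 2 :=
    ⟨fun x => Nat.find (hq x), measurable_find hq fun n =>
      measurableSet_lt (by fun_prop) measurable_const, fun x => Nat.find_spec (hq x)⟩
  let G : ℕ → Ω.Bundle → ℂ := fun n p => if N p.1.2 = n then F p else 0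
  have he : ∀ n, Measurable (localEval (q n) (G n)) := fun n => by
    refine measurable_localEval (q n)
      (Measurable.ite (p := fun p : Ω.Bundle => N p.1.2 = n) ?_ hF measurable_const)
    exact (hN.comp (measurable_snd.comp measurable_subtype_coe)) (measurableSet_singleton n)
  have hfib : ∀ n (ω : Ω.Pt), localEval (q n) (G n) ω =
      ∑' b : (fun x : ω.1 => N x) ⁻¹' {n}, F ⟨(ω, b.1), b.1.2⟩ := by
    intro n ω
    by_cases h : ∃ x : ω.1, N x = n
    · obtain ⟨x, hx⟩ := h
      have hxq : dist (x : Space d) (q n) < r / 2 := hx ▸ hNq x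
      have huniq : ∀ y : ω.1, N y = n → y = x := by
        intro y hy
        have hyq : dist (y : Space d) (q n) < r / 2 := hy ▸ hNq y
        have hyx : (y : Space d) = x :=
          eq_of_dist_lt (Ω.isDeloneSet _ ω.2) y.2 x.2 hyq hxq
        exact Subtype.ext hyx
      rw [localEval_eq (G n) x hxq]
      have hG : G n ⟨(ω, x), x.2⟩ = F ⟨(ω, x), x.2⟩ := if_pos hx
      rw [hG]
      symm
      refine tsum_eq_single (f := fun b : (fun x : ω.1 => N x) ⁻¹' {n} => F ⟨(ω, b.1), b.1.2⟩)
        ⟨x, hx⟩ ?_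
      intro b hne
      exact absurd (Subtype.ext (huniq b.1 b.2)) hne
    · have : IsEmpty ((fun x : ω.1 => N x) ⁻¹' {n}) := ⟨fun b => h ⟨b.1, b.2⟩⟩
      rw [tsum_empty]
      exact localEval_eq_zero fun x _ => if_neg fun hx => h ⟨x, hx⟩
  refine measurable_of_tendsto_metrizable
    (f := fun n ω => ∑ i ∈ Finset.range n, localEval (q i) (G i) ω)
    (fun n => Finset.measurable_fun_sum _ fun i _ => he i) ?_
  rw [tendsto_pi_nhds]
  intro ω
  have h1 := (hs ω).hasSum.tsum_fiberwise (fun x : ω.1 => N x)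
  have h2 : HasSum (fun n => localEval (q n) (G n) ω) (∑' x : ω.1, F ⟨(ω, x), x.2⟩) := by
    rw [show (fun n => localEval (q n) (G n) ω) = _ from funext fun n => hfib n ω]
    exact h1
  exact h2.tendsto_sum_nat

theorem measurable_inner {f g : Ω.Section} (hf : Ω.MeasurableSection f)
    (hg : Ω.MeasurableSection g) : Measurable fun ω => ⟪f ω, g ω⟫_ℂ := by
  let F : Ω.Bundle → ℂ := fun p =>
    g p.1.1 ⟨p.1.2, p.2⟩ * (starRingEnd ℂ) (f p.1.1 ⟨p.1.2, p.2⟩)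
  have hF : Measurable F := hg.mul (Complex.continuous_conj.measurable.comp hf)
  have h : (fun ω => ⟪f ω, g ω⟫_ℂ) = fun ω : Ω.Pt => ∑' x : ω.1, F ⟨(ω, x), x.2⟩ := by
    funext ω
    exact lp.inner_eq_tsum _ _
  rw [h]
  exact measurable_tsum_bundle hF fun ω => lp.summable_inner (f ω) (g ω)

theorem MeasurableFamily.apply {A : Ω.OpFamily} (hA : MeasurableFamily A) {g : Ω.Section}
    (hg : Ω.MeasurableSection g) : Ω.MeasurableSection fun ω => A ω (g ω) :=
  measurableSection_of_inner fun f hf => hA f g hf hg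

variable (Ω) in
/-- The covariant, measurable, bounded families of operators: a `*`-algebra under the pointwise
operations. -/
def randomFamilies : StarSubalgebra ℂ Ω.OpFamily where
  carrier := {A | Covariant A ∧ MeasurableFamily A ∧ BoundedFamily A}
  mul_mem' := by
    rintro A B ⟨hA, hA', K, hK⟩ ⟨hB, hB', L, hL⟩
    refine ⟨fun t ω => ?_, fun f g hf hg => hA' f _ hf (hB'.apply hg), K * L, fun ω => ?_⟩
    · ext1 g
      simp [hA t ω, hB t ω]
    · exact (norm_mul_le _ _).trans (mul_le_mul (hK ω) (hL ω) (norm_nonneg _)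
        ((norm_nonneg _).trans (hK ω)))
  add_mem' := by
    rintro A B ⟨hA, hA', K, hK⟩ ⟨hB, hB', L, hL⟩
    refine ⟨fun t ω => ?_, fun f g hf hg => ?_, K + L, fun ω => ?_⟩
    · ext1 g
      simp [hA t ω, hB t ω]
    · simp only [Pi.add_apply, add_apply, inner_add_right]
      exact (hA' f g hf hg).add (hB' f g hf hg)
    · exact (norm_add_le _ _).trans (add_le_add (hK ω) (hL ω))
  algebraMap_mem' := by
    intro c
    refine ⟨fun t ω => ?_, fun f g hf hg => ?_, ‖c‖, fun ω => ?_⟩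
    · ext1 g
      simp [Algebra.algebraMap_eq_smul_one]
    · simp only [Algebra.algebraMap_eq_smul_one, Pi.smul_apply, Pi.one_apply,
        smul_apply, one_apply_eq_self, inner_smul_right]
      exact (measurable_inner hf hg).const_mul c
    · refine ContinuousLinearMap.opNorm_le_bound _ (norm_nonneg _) fun g => ?_
      simp [Algebra.algebraMap_eq_smul_one, norm_smul]
  star_mem' := by
    rintro A ⟨hA, hA', K, hK⟩
    refine ⟨fun t ω => ?_, fun f g hf hg => ?_, K, fun ω => ?_⟩
    · ext1 g
      refine ext_inner_left ℂ fun h => ?_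
      have h1 : ⟪h, star A (t +ᵥ ω) g⟫_ℂ = ⟪A (t +ᵥ ω) h, g⟫_ℂ :=
        ContinuousLinearMap.adjoint_inner_right _ _ _
      have h2 : ∀ u v, ⟪u, star A ω v⟫_ℂ = ⟪A ω u, v⟫_ℂ := fun u v =>
        ContinuousLinearMap.adjoint_inner_right _ _ _
      rw [h1, hA t ω]
      let U := shiftUnitary t ω.1
      change ⟪U (A ω (U.symm h)), g⟫_ℂ = ⟪h, U (star A ω (U.symm g))⟫_ℂ
      rw [← U.symm.inner_map_map (U _), U.symm_apply_apply, ← h2,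
        ← U.inner_map_map (U.symm h), U.apply_symm_apply]
    · have h := hA' g f hg hf
      have : ∀ ω, ⟪f ω, star A ω (g ω)⟫_ℂ = star ⟪g ω, A ω (f ω)⟫_ℂ := fun ω => by
        simp [ContinuousLinearMap.star_eq_adjoint, ContinuousLinearMap.adjoint_inner_right]
      simp_rw [this]
      exact Complex.continuous_conj.measurable.comp h
    · exact (norm_star (A ω)).trans_le (hK ω)


section RandomOperators
variable (Ω) (μ : Measure Ω.Pt)

/-- The families which vanish `μ`-almost everywhere. -/
def nullIdeal : Ideal (randomFamilies Ω) where
  carrier := {A | ∀ᵐ ω ∂μ, (A : Ω.OpFamily) ω = 0}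
  zero_mem' := by
    change ∀ᵐ ω ∂μ, (0 : Ω.OpFamily) ω = 0
    simp
  add_mem' := by
    intro A B hA hB
    change ∀ᵐ ω ∂μ, (A : Ω.OpFamily) ω + (B : Ω.OpFamily) ω = 0
    filter_upwards [hA, hB] with ω h1 h2
    rw [h1, h2, add_zero]
  smul_mem' := by
    intro A B hB
    change ∀ᵐ ω ∂μ, (A : Ω.OpFamily) ω * (B : Ω.OpFamily) ω = 0
    filter_upwards [hB] with ω h
    rw [h, mul_zero]

instance : (nullIdeal Ω μ).IsTwoSided where
  mul_mem_of_left {A} B hA := by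
    change ∀ᵐ ω ∂μ, (A : Ω.OpFamily) ω * (B : Ω.OpFamily) ω = 0
    filter_upwards [hA] with ω h
    rw [h, zero_mul]

/-- The algebra `𝒩` of random operators. -/
abbrev RandomOperator : Type := randomFamilies Ω ⧸ nullIdeal Ω μ

variable {Ω μ}

/-- A representative of the class `A ∈ 𝒩`, evaluated at `ω`; it is determined for `μ`-almost
every `ω`. -/
def RandomOperator.fiber (A : RandomOperator Ω μ) (ω : Ω.Pt) : Ell2 ω.1 →L[ℂ] Ell2 ω.1 :=
  (Quotient.out A : randomFamilies Ω).1 ω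

theorem RandomOperator.mk_eq_mk_iff {A B : randomFamilies Ω} :
    (Ideal.Quotient.mk (nullIdeal Ω μ) A = Ideal.Quotient.mk (nullIdeal Ω μ) B) ↔
      ∀ᵐ ω ∂μ, A.1 ω = B.1 ω := by
  rw [Ideal.Quotient.eq]
  change (∀ᵐ ω ∂μ, A.1 ω - B.1 ω = 0) ↔ _
  simp only [sub_eq_zero]

theorem RandomOperator.fiber_mk (A : randomFamilies Ω) :
    ∀ᵐ ω ∂μ, RandomOperator.fiber (Ideal.Quotient.mk (nullIdeal Ω μ) A) ω = A.1 ω :=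
  RandomOperator.mk_eq_mk_iff.1 (Quotient.out_eq (Ideal.Quotient.mk (nullIdeal Ω μ) A))

/-- The norm of `𝒩`: the essential supremum of `‖A_ω‖`. -/
def RandomOperator.opNorm (A : RandomOperator Ω μ) : ℝ :=
  sInf {K : ℝ | 0 ≤ K ∧ ∀ᵐ ω ∂μ, ‖A.fiber ω‖ ≤ K}

/-- `A ∈ 𝒩⁺`. -/
def RandomOperator.Nonneg (A : RandomOperator Ω μ) : Prop :=
  ∀ᵐ ω ∂μ, (A.fiber ω).IsPositive

/-- `A = A^*` in `𝒩`. -/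
def RandomOperator.SelfAdjoint (A : RandomOperator Ω μ) : Prop :=
  ∀ᵐ ω ∂μ, IsSelfAdjoint (A.fiber ω)

variable (Ω μ) in
/-- The (representatives of) elements of the direct integral of the spaces `ℓ²(ω)`, that is, of
`L²(𝒳, μ ∘ α)`. -/
def L2Section : Type :=
  {f : Ω.Section // Ω.MeasurableSection f ∧ Integrable (fun ω => ‖f ω‖ ^ 2) μ}

variable (Ω μ) in
/-- The weak operator topology of `𝒩`, acting fibrewise on the direct integral of the `ℓ²(ω)`. -/
abbrev weakOperatorTopology : TopologicalSpace (RandomOperator Ω μ) :=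
  TopologicalSpace.induced
    (fun A (p : L2Section Ω μ × L2Section Ω μ) => ∫ ω, ⟪p.1.1 ω, A.fiber ω (p.2.1 ω)⟫_ℂ ∂μ)
    inferInstance

end RandomOperators

end DeloneSystem

/-- A nonnegative `f ∈ C_c(ℝ^d)` with integral one. -/
def IsNormalized {d : ℕ} (f : C_c(Space d, ℝ)) : Prop :=
  (∀ x, 0 ≤ f x) ∧ ∫ x, f x = 1

section BorelCalculus
variable {H : Type*} [NormedAddCommGroup H] [InnerProductSpace ℂ H] [CompleteSpace H]

/-- `m` is the spectral measure of the bounded selfadjoint operator `T` at the vector `x`: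
`∫ g dm = ⟨x, g(T) x⟩` for continuous `g`. -/
def IsSpectralMeasureAt (T : H →L[ℂ] H) (x : H) (m : Measure ℝ) : Prop :=
  IsFiniteMeasure m ∧ ∀ g : BoundedContinuousFunction ℝ ℝ,
    ((∫ t, g t ∂m : ℝ) : ℂ) = ⟪x, cfc (g : ℝ → ℝ) T x⟫_ℂ

/-- `S = F(T)` for a bounded selfadjoint operator `T` and a bounded Borel function `F`:
`⟨x, S x⟩ = ∫ F dm_x` for all vectors `x`, with `m_x` the spectral measure of `T` at `x`. -/
def IsBorelFunctionOf (T : H →L[ℂ] H) (F : ℝ → ℂ) (S : H →L[ℂ] H) : Prop :=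
  ∀ x, ∃ m : Measure ℝ, IsSpectralMeasureAt T x m ∧ ⟪x, S x⟫_ℂ = ∫ t, F t ∂m

end BorelCalculus

/-- `C = F(A)` in `𝒩`, for selfadjoint `A` and a bounded Borel function `F`. -/
def DeloneSystem.RandomOperator.IsFunctionOf {d : ℕ} {r R : ℝ} {Ω : DeloneSystem d r R}
    {μ : Measure Ω.Pt} (A : RandomOperator Ω μ) (F : ℝ → ℂ) (C : RandomOperator Ω μ) : Prop :=
  ∀ᵐ ω ∂μ, IsBorelFunctionOf (A.fiber ω) F (C.fiber ω)

end Delone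
end

noncomputable section

namespace Delone

/-! ### Translations act continuously, hence measurably. -/

namespace ClosedSubset
variable {d : ℕ}

/-! Partition `ℝ^d` into countably many measurable cells of diameter less than `r`. A set `ω` has at
most one point in each cell, so sums over `ω` become sums over a fixed countable index set, with
terms built from measurable sections. The weight `f` meets only finitely many cells, so `tr(A_ω
M_f)` is a finite sum of matrix elements `⟨h_i, A_ω h_i⟩` with bounded measurable sections `h_i = √f
δ_x` (`exists_tr_eq_sum`). This yields integrability, both kinds of continuity, and positivity.

Independence of `f` and the trace property come from one mass transport identity,
`lintegral_pairSum_eq`: the integral of `∑ f(x) |⟨δ_x, A_ω δ_y⟩|²` equals that of `∑ g(y) |⟨δ_x, A_ω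
δ_y⟩|²` for normalized `f`, `g`. To see this, insert the factor `∫ g(y + t) dt = 1`, use Tonelli,
and translate `ω` by `-t`. Thus `τ_f(A*A) = τ_g(AA*)`, and polarization gives `τ_f(AB) = τ_g(BA)`.
Here `B = 1` is independence and `f = g` is the trace property. If `A ≥ 0` has trace zero, then `A_ω
δ_x = 0` almost surely wherever `f(x) ≠ 0`; countably many choices of `f` cover all points, so `A =
0`.

For the functional calculus, Riesz–Markov–Kakutani gives scalar spectral measures `m_x`, and `F(T)`
is the operator with quadratic form `x ↦ ∫ F dm_x`. Linear relations between quadratic forms hold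
for continuous `F` and pass to Borel `F` by `L¹` approximation. Uniqueness of `F(T)` gives
covariance of `F(A_ω)`; measurability of `ω ↦ m_ω` gives its measurability. The measure `ρ_A` is the
sum over `i` of the `μ`-mixtures of the spectral measures of `A_ω` at `h_i(ω)`.

Faithfulness turns `ρ_A(U) = 0` into `χ_U(A) = 0`, which for open `U` says that `σ(A_ω)` almost
surely misses `U`. Testing this on a countable basis gives the support statements. In the ergodic
case `{ω : χ_U(A_ω) = 0}` is an invariant measurable set, so each basic `U` is almost surely missed
or almost surely met. -/

theorem localDist_vadd_le {k l : ℕ} {t : Space d} (h : k + ‖t‖ ≤ l) (F G : ClosedSubset d) :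
    localDist k (t +ᵥ F) (t +ᵥ G) ≤ localDist l F G := by
  have key : ∀ (F G : ClosedSubset d) (ε : ℝ),
      (F : Set (Space d)) ∩ Metric.closedBall 0 l ⊆ Metric.thickening ε G →
      ((t +ᵥ F : ClosedSubset d) : Set (Space d)) ∩ Metric.closedBall 0 k ⊆
        Metric.thickening ε (t +ᵥ G : ClosedSubset d) := by
    rintro F G ε hFG x ⟨hx, hxk⟩
    have hxl : x - t ∈ Metric.closedBall (0 : Space d) l := by
      rw [mem_closedBall_zero_iff] at hxk ⊢
      linarith [norm_sub_le x t]
    obtain ⟨z, hz, hxz⟩ := Metric.mem_thickening_iff.1 (hFG ⟨hx, hxl⟩)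
    refine Metric.mem_thickening_iff.2 ⟨z + t, ?_, ?_⟩
    · change z + t - t ∈ G
      rwa [add_sub_cancel_right]
    · rwa [← sub_add_cancel x t, dist_add_right]
  refine csInf_le_csInf ⟨0, ?_⟩ ⟨1, Or.inr rfl⟩ (union_subset_union_left _ ?_)
  · rintro ε (hε | rfl)
    · exact hε.1.le
    · exact zero_le_one
  · rintro ε ⟨h0, h1, h2⟩
    exact ⟨h0, key F G ε h1, key G F ε h2⟩

theorem continuous_vadd (t : Space d) : Continuous fun F : ClosedSubset d => t +ᵥ F := by
  refine continuous_def.2 fun V hV F hF => ?_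
  obtain ⟨ε, hε, k, hk⟩ := hV _ hF
  obtain ⟨l, hl⟩ := exists_nat_ge (k + ‖t‖)
  exact ⟨ε, hε, l, fun G hG => hk _ ((localDist_vadd_le hl F G).trans hG)⟩

end ClosedSubset

namespace DeloneSystem
variable {d : ℕ} {r R : ℝ} {Ω : DeloneSystem d r R}

theorem measurable_vadd (t : Space d) : Measurable fun ω : Ω.Pt => t +ᵥ ω :=
  (((ClosedSubset.continuous_vadd t).measurable).comp measurable_subtype_coe).subtype_mk

theorem measurePreserving_vadd_pt (μ : Measure Ω.Pt) [VAddInvariantMeasure (Space d) Ω.Pt μ]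
    (t : Space d) : MeasurePreserving (fun ω : Ω.Pt => t +ᵥ ω) μ μ :=
  ⟨measurable_vadd t, Measure.ext fun s hs => by
    rw [Measure.map_apply (measurable_vadd t) hs, VAddInvariantMeasure.measure_preimage_vadd t hs]⟩

/-! ### A countable partition separating the points of every `ω`. -/

section Cells

/-- The `n`-th point of a dense sequence. -/
def center (d n : ℕ) : Space d := TopologicalSpace.denseSeq (Space d) n

theorem exists_dist_center_lt (Ω : DeloneSystem d r R) (x : Space d) :
    ∃ n, dist x (center d n) < r / 2 :=
  (TopologicalSpace.denseRange_denseSeq (Space d)).exists_dist_lt x (half_pos Ω.r_pos)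

open Classical in
/-- The index of the cell containing `x`, in a partition of `ℝ^d` into sets of diameter less
than `r`. -/
def cell (Ω : DeloneSystem d r R) (x : Space d) : ℕ := Nat.find (exists_dist_center_lt Ω x)

theorem dist_center_cell_lt (Ω : DeloneSystem d r R) (x : Space d) :
    dist x (center d (cell Ω x)) < r / 2 :=
  Nat.find_spec (exists_dist_center_lt Ω x)

theorem cell_le (Ω : DeloneSystem d r R) {x : Space d} {n : ℕ}
    (h : dist x (center d n) < r / 2) : cell Ω x ≤ n :=
  Nat.find_min' _ h

theorem measurable_cell (Ω : DeloneSystem d r R) : Measurable (cell Ω) := by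
  classical
  exact measurable_find _ fun n => measurableSet_lt (by fun_prop) measurable_const

/-- Two points in one cell are both within `r / 2` of its centre, hence closer than the minimal
distance `r`. -/
theorem cell_injective (ω : Ω.Pt) : Function.Injective fun x : ω.1 => cell Ω x := by
  intro x y h
  have h' : cell Ω x = cell Ω y := h
  exact Subtype.ext (eq_of_dist_lt (Ω.isDeloneSet _ ω.2) x.2 y.2 (dist_center_cell_lt Ω x)
    (h' ▸ dist_center_cell_lt Ω y))

instance countable_pt (ω : Ω.Pt) : Countable ω.1 := (cell_injective ω).countable

/-- Finitely many balls about centres cover `K`, and the cell index is the least index of a ball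
containing the point. -/
theorem exists_cell_lt (Ω : DeloneSystem d r R) {K : Set (Space d)} (hK : IsCompact K) :
    ∃ n, ∀ x ∈ K, cell Ω x < n := by
  obtain ⟨s, hs⟩ := hK.elim_finite_subcover
    (fun n => Metric.ball (center d n) (r / 2)) (fun _ => Metric.isOpen_ball)
    (fun x _ => mem_iUnion.2 (exists_dist_center_lt Ω x))
  refine ⟨s.sup id + 1, fun x hx => Nat.lt_succ_of_le ?_⟩
  obtain ⟨n, hn, hxn⟩ := mem_iUnion₂.1 (hs hx)
  exact (cell_le Ω hxn).trans (Finset.le_sup (f := id) hn)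

open Classical in
/-- The section `ω ↦ v(x) δ_x`, with `x` the point of `ω` in the `n`-th cell, if there is one. -/
def cellSection (v : Space d → ℂ) (n : ℕ) : Ω.Section := fun ω =>
  if h : ∃ x : ω.1, cell Ω x = n then lp.single 2 h.choose (v h.choose) else 0

open Classical in
theorem cellSection_cell (v : Space d → ℂ) {ω : Ω.Pt} (x : ω.1) :
    cellSection v (cell Ω x) ω = lp.single 2 x (v x) := by
  have h : ∃ y : ω.1, cell Ω y = cell Ω x := ⟨x, rfl⟩
  rw [cellSection, dif_pos h]
  congr!
  exact cell_injective ω h.choose_spec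

theorem cellSection_of_forall_ne (v : Space d → ℂ) {ω : Ω.Pt} {n : ℕ}
    (h : ∀ x : ω.1, cell Ω x ≠ n) : cellSection v n ω = 0 :=
  dif_neg fun ⟨x, hx⟩ => h x hx

theorem cellSection_apply (v : Space d → ℂ) (n : ℕ) (p : Ω.Bundle) :
    cellSection v n p.1.1 ⟨p.1.2, p.2⟩ = if cell Ω p.1.2 = n then v p.1.2 else 0 := by
  classical
  split_ifs with h
  · subst h
    rw [cellSection_cell v (⟨p.1.2, p.2⟩ : p.1.1.1)]
    simp
  · by_cases h' : ∃ x : p.1.1.1, cell Ω x = n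
    · obtain ⟨x, rfl⟩ := h'
      rw [cellSection_cell, lp.single_apply_ne]
      rintro rfl
      exact h rfl
    · rw [cellSection_of_forall_ne v fun x hx => h' ⟨x, hx⟩]
      rfl

theorem measurableSection_cellSection {v : Space d → ℂ} (hv : Measurable v) (n : ℕ) :
    Ω.MeasurableSection (cellSection v n) := by
  unfold MeasurableSection
  simp_rw [cellSection_apply]
  have hm : Measurable fun p : Ω.Bundle => p.1.2 := measurable_snd.comp measurable_subtype_coe
  exact Measurable.ite ((measurable_cell Ω).comp hm (measurableSet_singleton n)) (hv.comp hm)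
    measurable_const

theorem norm_cellSection_le {v : Space d → ℂ} {K : ℝ} (hv : ∀ x, ‖v x‖ ≤ K) (n : ℕ) (ω : Ω.Pt) :
    ‖(cellSection v n : Ω.Section) ω‖ ≤ K := by
  classical
  have hK : 0 ≤ K := (norm_nonneg _).trans (hv 0)
  by_cases h : ∃ x : ω.1, cell Ω x = n
  · obtain ⟨x, rfl⟩ := h
    rw [cellSection_cell, lp.norm_single (by norm_num)]
    exact hv x
  · rw [cellSection_of_forall_ne v fun x hx => h ⟨x, hx⟩, norm_zero]
    exact hK

/-- A sum over `ω` as a sum over the cells. -/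
theorem tsum_cell {M : Type*} [AddCommMonoid M] [TopologicalSpace M] {ω : Ω.Pt} {G : ℕ → M}
    {F : ω.1 → M} (h : ∀ x : ω.1, G (cell Ω x) = F x)
    (h0 : ∀ n, (∀ x : ω.1, cell Ω x ≠ n) → G n = 0) : ∑' n, G n = ∑' x, F x := by
  rw [← (cell_injective ω).tsum_eq]
  · exact tsum_congr h
  · intro n hn
    by_contra hn'
    exact hn (h0 n fun x hx => hn' ⟨x, hx⟩)

/-- The point of `ω` in the `n`-th cell; a junk value if there is none. -/
def cellPoint (n : ℕ) (ω : Ω.Pt) : Space d := WithLp.toLp 2 fun i =>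
  (localEval (center d n) (fun p : Ω.Bundle => ((p.1.2 i : ℝ) : ℂ)) ω).re

theorem measurable_cellPoint (n : ℕ) : Measurable (cellPoint n : Ω.Pt → Space d) := by
  refine (PiLp.continuous_toLp 2 _).measurable.comp (measurable_pi_lambda _ fun i => ?_)
  refine Complex.measurable_re.comp (measurable_localEval _ ?_)
  refine Complex.measurable_ofReal.comp ?_
  have hm : Measurable fun p : Ω.Bundle => p.1.2 := measurable_snd.comp measurable_subtype_coe
  exact (EuclideanSpace.proj (𝕜 := ℝ) i).continuous.measurable.comp hm

theorem cellPoint_cell {ω : Ω.Pt} (x : ω.1) : cellPoint (cell Ω x) ω = x := by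
  ext i
  rw [cellPoint]
  change (localEval _ _ ω).re = _
  rw [localEval_eq _ x (dist_center_cell_lt Ω x)]
  simp

end Cells

/-! ### The weighted trace as a finite sum of matrix elements. -/

section Trace

open Classical in
theorem tr_comp_mulOp (f : C_c(Space d, ℝ)) {ω : ClosedSubset d}
    (T : Ell2 ω →L[ℂ] Ell2 ω) : tr (T ∘L mulOp f ω) =
      ∑' x : ω, (f (x : Space d) : ℂ) * ⟪lp.single 2 x (1 : ℂ), T (lp.single 2 x (1 : ℂ))⟫_ℂ := by
  refine tsum_congr fun x => ?_
  have h : mulOp f ω (lp.single 2 x (1 : ℂ)) = (f (x : Space d) : ℂ) • lp.single 2 x (1 : ℂ) := by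
    ext y
    rw [mulOp_apply, lp.coeFn_smul, Pi.smul_apply, smul_eq_mul]
    by_cases hy : y = x
    · rw [hy]
    · simp [hy]
  rw [ContinuousLinearMap.comp_apply]
  rw [h, map_smul, inner_smul_right]

/-- The square root of `f`, as a complex function. -/
def sqrtFun (f : C_c(Space d, ℝ)) (x : Space d) : ℂ := (Real.sqrt (f x) : ℂ)

theorem measurable_sqrtFun (f : C_c(Space d, ℝ)) : Measurable (sqrtFun f) :=
  Complex.measurable_ofReal.comp (Real.continuous_sqrt.comp f.continuous).measurable

theorem exists_norm_sqrtFun_le (f : C_c(Space d, ℝ)) : ∃ K, ∀ x, ‖sqrtFun f x‖ ≤ K := by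
  obtain ⟨K, hK⟩ := f.hasCompactSupport.exists_bound_of_continuous f.continuous
  refine ⟨Real.sqrt K, fun x => ?_⟩
  rw [sqrtFun, Complex.norm_real, Real.norm_of_nonneg (Real.sqrt_nonneg _)]
  exact Real.sqrt_le_sqrt ((le_abs_self _).trans (hK x))

/-- The trace of `T M_f` as a finite sum of matrix elements in measurable sections. -/
theorem exists_tr_eq_sum (Ω : DeloneSystem d r R) {f : C_c(Space d, ℝ)} (hf : ∀ x, 0 ≤ f x) :
    ∃ n : ℕ, (∀ x, f x ≠ 0 → cell Ω x < n) ∧ ∀ (ω : Ω.Pt) (T : Ell2 ω.1 →L[ℂ] Ell2 ω.1), tr (T ∘L mulOp f ω.1) =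
      ∑ i ∈ Finset.range n, ⟪(cellSection (sqrtFun f) i : Ω.Section) ω,
        T ((cellSection (sqrtFun f) i : Ω.Section) ω)⟫_ℂ := by
  classical
  obtain ⟨n, hn⟩ := exists_cell_lt Ω f.hasCompactSupport.isCompact
  refine ⟨n, fun x hx => hn x (subset_tsupport _ hx), fun ω T => ?_⟩
  -- Splitting `f(x) = √f(x) · √f(x)` between the two sides of the inner product produces diagonal
  -- matrix elements, so positivity of `T` is visible in each summand.
  have key : ∀ x : ω.1, ⟪(cellSection (sqrtFun f) (cell Ω x) : Ω.Section) ω,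
      T ((cellSection (sqrtFun f) (cell Ω x) : Ω.Section) ω)⟫_ℂ =
      (f (x : Space d) : ℂ) * ⟪lp.single 2 x (1 : ℂ), T (lp.single 2 x (1 : ℂ))⟫_ℂ := by
    intro x
    have h1 : (lp.single 2 x (sqrtFun f x) : Ell2 ω.1) = sqrtFun f x • lp.single 2 x (1 : ℂ) := by
      rw [← lp.single_smul]
      simp
    rw [cellSection_cell, h1, map_smul, inner_smul_left, inner_smul_right, ← mul_assoc]
    congr 1
    rw [sqrtFun, Complex.conj_ofReal, ← Complex.ofReal_mul, Real.mul_self_sqrt (hf x)]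
  rw [tr_comp_mulOp, ← tsum_cell (G := fun m => ⟪(cellSection (sqrtFun f) m : Ω.Section) ω,
    T ((cellSection (sqrtFun f) m : Ω.Section) ω)⟫_ℂ) key fun m hm => by
      rw [cellSection_of_forall_ne _ hm]; simp]
  refine tsum_eq_sum fun m hm => ?_
  by_cases h : ∃ x : ω.1, cell Ω x = m
  · obtain ⟨x, rfl⟩ := h
    rw [key]
    have : f (x : Space d) = 0 := by
      by_contra h0
      exact hm (Finset.mem_range.2 (hn x (subset_tsupport _ h0)))
    rw [this]
    simp
  · rw [cellSection_of_forall_ne _ fun x hx => h ⟨x, hx⟩]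
    simp

end Trace

end DeloneSystem

end Delone

namespace Delone
namespace DeloneSystem
variable {d : ℕ} {r R : ℝ} {Ω : DeloneSystem d r R}

/-! ### Mass transport for squared matrix elements. -/

section Transport

open Classical in
theorem shiftUnitary_single (t : Space d) {ω : ClosedSubset d} (x : ω) :
    shiftUnitary t ω (lp.single 2 x (1 : ℂ)) = lp.single 2 (shiftEquiv t ω x) (1 : ℂ) := by
  ext y
  change (lp.single 2 x (1 : ℂ) : Ell2 ω) ((shiftEquiv t ω).symm y) = _
  by_cases h : y = shiftEquiv t ω x
  · subst h
    simp
  · have h' : (shiftEquiv t ω).symm y ≠ x := fun e => h (by rw [← e, Equiv.apply_symm_apply])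
    rw [lp.single_apply_ne _ _ _ h', lp.single_apply_ne _ _ _ h]

open Classical in
theorem tsum_enorm_inner_single {ω : ClosedSubset d} (v : Ell2 ω) :
    ∑' x : ω, ‖⟪lp.single 2 x (1 : ℂ), v⟫_ℂ‖ₑ ^ 2 = ‖v‖ₑ ^ 2 := by
  have h : ∀ x : ω, ‖⟪lp.single 2 x (1 : ℂ), v⟫_ℂ‖ₑ ^ 2 = ENNReal.ofReal (‖v x‖ ^ 2) := fun x => by
    rw [lp.inner_single_left, ENNReal.ofReal_pow (norm_nonneg _), ofReal_norm]
    simp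
  simp_rw [h]
  rw [← ENNReal.ofReal_tsum_of_nonneg (fun _ => by positivity) ((memℓp_two_iff _).1 v.2),
    ← norm_sq_eq_tsum, ENNReal.ofReal_pow (norm_nonneg _), ofReal_norm]

open Classical in
/-- The sum of the squares of the matrix elements of `A_ω`, weighted by `w`. -/
def pairSum (A : Ω.OpFamily) (w : Space d → Space d → ℝ≥0∞) (ω : Ω.Pt) : ℝ≥0∞ :=
  ∑' x : ω.1, ∑' y : ω.1,
    w x y * ‖⟪lp.single 2 x (1 : ℂ), A ω (lp.single 2 y (1 : ℂ))⟫_ℂ‖ₑ ^ 2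

open Classical in
-- Parseval: `∑_y |⟨δ_x, A δ_y⟩|² = ‖A* δ_x‖²`. Weights on the other index give `‖A δ_y‖²` instead,
-- so moving the weight across exchanges `A*A` and `AA*`.
theorem pairSum_left (A : Ω.OpFamily) (w : Space d → ℝ≥0∞) (ω : Ω.Pt) :
    pairSum A (fun x _ => w x) ω =
      ∑' x : ω.1, w x * ‖star (A ω) (lp.single 2 x (1 : ℂ))‖ₑ ^ 2 := by
  refine tsum_congr fun x => ?_
  rw [ENNReal.tsum_mul_left, ← tsum_enorm_inner_single]
  congr 1
  refine tsum_congr fun y => ?_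
  rw [ContinuousLinearMap.star_eq_adjoint, ContinuousLinearMap.adjoint_inner_right,
    ← inner_conj_symm, RCLike.enorm_conj]

open Classical in
theorem pairSum_right (A : Ω.OpFamily) (w : Space d → ℝ≥0∞) (ω : Ω.Pt) :
    pairSum A (fun _ y => w y) ω = ∑' y : ω.1, w y * ‖A ω (lp.single 2 y (1 : ℂ))‖ₑ ^ 2 := by
  rw [pairSum, ENNReal.tsum_comm]
  refine tsum_congr fun y => ?_
  rw [ENNReal.tsum_mul_left, ← tsum_enorm_inner_single]

/-- The index set no longer depends on `ω`, which makes every term measurable. The junk values of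
`cellPoint` on empty cells are harmless, as `cellSection` vanishes there. -/
theorem pairSum_eq_tsum_cell (A : Ω.OpFamily) (w : Space d → Space d → ℝ≥0∞) (ω : Ω.Pt) :
    pairSum A w ω = ∑' (m : ℕ) (n : ℕ), w (cellPoint m ω) (cellPoint n ω) *
      ‖⟪(cellSection 1 m : Ω.Section) ω, A ω ((cellSection 1 n : Ω.Section) ω)⟫_ℂ‖ₑ ^ 2 := by
  symm
  refine tsum_cell (fun x => ?_) fun m hm => ?_
  · refine tsum_cell (fun y => ?_) fun n hn => ?_
    · rw [cellPoint_cell, cellPoint_cell, cellSection_cell, cellSection_cell]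
      rfl
    · rw [cellSection_of_forall_ne _ hn]
      simp
  · rw [cellSection_of_forall_ne _ hm]
    simp

/-- The parameter in `T` provides the joint measurability that Tonelli needs in the translation
variable. -/
theorem measurable_pairSum {T : Type*} [MeasurableSpace T] {A : Ω.OpFamily}
    (hA : MeasurableFamily A) {w : T → Space d → Space d → ℝ≥0∞}
    (hw : Measurable fun p : T × Space d × Space d => w p.1 p.2.1 p.2.2) :
    Measurable fun p : T × Ω.Pt => pairSum A (w p.1) p.2 := by
  simp_rw [pairSum_eq_tsum_cell]
  refine Measurable.tsum fun m => Measurable.tsum fun n => Measurable.mul ?_ ?_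
  · exact hw.comp (measurable_fst.prodMk (((measurable_cellPoint m).comp measurable_snd).prodMk
      ((measurable_cellPoint n).comp measurable_snd)))
  · exact ((hA _ _ (measurableSection_cellSection measurable_one m)
      (measurableSection_cellSection measurable_one n)).comp measurable_snd).enorm.pow_const 2

/-- By covariance the matrix element of `A_{ω+t}` at `(x + t, y + t)` is that of `A_ω` at `(x, y)`.
-/
theorem pairSum_vadd {A : Ω.OpFamily} (hA : Covariant A) (w : Space d → Space d → ℝ≥0∞)
    (t : Space d) (ω : Ω.Pt) :
    pairSum A w (t +ᵥ ω) = pairSum A (fun x y => w (x + t) (y + t)) ω := by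
  classical
  let e : ω.1 ≃ (t +ᵥ ω : Ω.Pt).1 := shiftEquiv t ω.1
  refine (e.tsum_eq _).symm.trans (tsum_congr fun x => ?_)
  refine (e.tsum_eq _).symm.trans (tsum_congr fun y => ?_)
  rw [hA t ω]
  have h : ∀ (z : ω.1), (lp.single 2 (shiftEquiv t ω.1 z) (1 : ℂ) : Ell2 (t +ᵥ ω.1)) =
      shiftUnitary t ω.1 (lp.single 2 z (1 : ℂ)) := fun z => (shiftUnitary_single t z).symm
  have hi : ⟪(lp.single 2 (shiftEquiv t ω.1 x) (1 : ℂ) : Ell2 (t +ᵥ ω.1)),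
      shiftUnitary t ω.1 (A ω ((shiftUnitary t ω.1).symm
        (lp.single 2 (shiftEquiv t ω.1 y) (1 : ℂ))))⟫_ℂ =
      ⟪lp.single 2 x (1 : ℂ), A ω (lp.single 2 y (1 : ℂ))⟫_ℂ := by
    rw [h, h, LinearIsometryEquiv.symm_apply_apply, LinearIsometryEquiv.inner_map_map]
  exact congrArg (fun z : ℂ => w (x + t) (y + t) * ‖z‖ₑ ^ 2) hi

theorem lintegral_pairSum (A : Ω.OpFamily) {w : Space d → Space d → Space d → ℝ≥0∞}
    (hw : ∀ x y, Measurable fun t => w t x y) (ω : Ω.Pt) :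
    ∫⁻ t, pairSum A (w t) ω = pairSum A (fun x y => ∫⁻ t, w t x y) ω := by
  simp_rw [pairSum]
  rw [lintegral_tsum fun x : ω.1 => (Measurable.tsum fun y : ω.1 => (hw x y).mul_const _).aemeasurable]
  refine tsum_congr fun x => ?_
  rw [lintegral_tsum fun y : ω.1 => ((hw x y).mul_const _).aemeasurable]
  exact tsum_congr fun y => lintegral_mul_const _ (hw x y)

theorem lintegral_ofReal_of_isNormalized {f : C_c(Space d, ℝ)} (hf : IsNormalized f) :
    ∫⁻ x, ENNReal.ofReal (f x) = 1 := by
  have hi : Integrable fun x => f x :=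
    f.continuous.integrable_of_hasCompactSupport f.hasCompactSupport
  rw [← ofReal_integral_eq_lintegral_ofReal hi (Eventually.of_forall hf.1), hf.2, ENNReal.ofReal_one]

/-- The mass transport identity, which carries both the independence of `f` and the trace property.
All terms are nonnegative, so the interchanges of integrals and sums are free. -/
theorem lintegral_pairSum_eq (μ : Measure Ω.Pt) [SFinite μ]
    [VAddInvariantMeasure (Space d) Ω.Pt μ] {A : Ω.OpFamily} (hA : A ∈ randomFamilies Ω)
    {f g : C_c(Space d, ℝ)} (hf : IsNormalized f) (hg : IsNormalized g) :
    ∫⁻ ω, pairSum A (fun x _ => ENNReal.ofReal (f x)) ω ∂μ =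
      ∫⁻ ω, pairSum A (fun _ y => ENNReal.ofReal (g y)) ω ∂μ := by
  have mf : Measurable fun x => ENNReal.ofReal (f x) := f.continuous.measurable.ennreal_ofReal
  have mg : Measurable fun x => ENNReal.ofReal (g x) := g.continuous.measurable.ennreal_ofReal
  -- Integrating over `t` removes the normalized factor that moves with `t`: `u` integrates to
  -- `f(x)` and `v` to `g(y)`.
  let u : Space d → Space d → Space d → ℝ≥0∞ := fun t x y =>
    ENNReal.ofReal (f x) * ENNReal.ofReal (g (y + t))
  let v : Space d → Space d → Space d → ℝ≥0∞ := fun t x y =>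
    ENNReal.ofReal (f (x - t)) * ENNReal.ofReal (g y)
  have hu : Measurable fun p : Space d × Space d × Space d => u p.1 p.2.1 p.2.2 :=
    (mf.comp (by fun_prop)).mul (mg.comp (by fun_prop))
  have hv : Measurable fun p : Space d × Space d × Space d => v p.1 p.2.1 p.2.2 :=
    (mf.comp (by fun_prop)).mul (mg.comp (by fun_prop))
  have mu : ∀ x y, Measurable fun t => u t x y := fun x y =>
    (mg.comp (measurable_const_add y)).const_mul _
  have mv : ∀ x y, Measurable fun t => v t x y := fun x y =>
    (mf.comp (measurable_const.sub measurable_id)).mul_const _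
  have iu : ∀ x y, ∫⁻ t, u t x y = ENNReal.ofReal (f x) := fun x y => by
    have hm : Measurable fun t => ENNReal.ofReal (g (y + t)) := mg.comp (measurable_const_add y)
    rw [lintegral_const_mul _ hm,
      lintegral_add_left_eq_self (fun t => ENNReal.ofReal (g t)) y, lintegral_ofReal_of_isNormalized hg, mul_one]
  have iv : ∀ x y, ∫⁻ t, v t x y = ENNReal.ofReal (g y) := fun x y => by
    have hm : Measurable fun t => ENNReal.ofReal (f (x - t)) :=
      mf.comp (measurable_const.sub measurable_id)
    rw [lintegral_mul_const _ hm,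
      lintegral_sub_left_eq_self (fun t => ENNReal.ofReal (f t)) x, lintegral_ofReal_of_isNormalized hf, one_mul]
  have h1 : ∀ ω : Ω.Pt, pairSum A (fun x _ => ENNReal.ofReal (f x)) ω =
      ∫⁻ t, pairSum A (u t) ω := fun ω => by
    rw [lintegral_pairSum A (w := u) mu]
    simp_rw [iu]
  have h2 : ∀ ω : Ω.Pt, pairSum A (fun _ y => ENNReal.ofReal (g y)) ω =
      ∫⁻ t, pairSum A (v t) ω := fun ω => by
    rw [lintegral_pairSum A (w := v) mv]
    simp_rw [iv]
  have h3 : ∀ t : Space d, ∫⁻ ω, pairSum A (u t) ω ∂μ = ∫⁻ ω, pairSum A (v t) ω ∂μ := fun t => by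
    have hm : Measurable fun ω : Ω.Pt => pairSum A (u t) ω :=
      (measurable_pairSum hA.2.1 hu).comp (measurable_const.prodMk measurable_id)
    -- Translating `ω` by `-t` turns `f(x) g(y + t)` into `f(x - t) g(y)`, that is, `u t` into `v
    -- t`.
    rw [← (measurePreserving_vadd_pt μ (-t)).lintegral_comp hm]
    refine lintegral_congr fun ω => ?_
    rw [pairSum_vadd hA.1]
    simp [u, v, sub_eq_add_neg]
  simp_rw [h1, h2]
  rw [lintegral_lintegral_swap (f := fun ω t => pairSum A (u t) ω)
      ((measurable_pairSum hA.2.1 hu).comp measurable_swap).aemeasurable,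
    lintegral_lintegral_swap (f := fun ω t => pairSum A (v t) ω)
      ((measurable_pairSum hA.2.1 hv).comp measurable_swap).aemeasurable, lintegral_congr h3]

end Transport

end DeloneSystem

end Delone

namespace Delone

namespace DeloneSystem
variable {d : ℕ} {r R : ℝ} {Ω : DeloneSystem d r R}

/-! ### The trace on families of operators. -/

section TraceIntegral

theorem pairSum_ne_top (A : Ω.OpFamily) (f : C_c(Space d, ℝ)) (ω : Ω.Pt) :
    pairSum A (fun _ y => ENNReal.ofReal (f y)) ω ≠ ∞ := by
  classical
  obtain ⟨n, hn⟩ := exists_cell_lt Ω f.hasCompactSupport.isCompact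
  have hfin : {x : ω.1 | cell Ω x < n}.Finite :=
    (Set.finite_Iio n).preimage (cell_injective ω).injOn
  rw [pairSum_right, tsum_eq_sum (s := hfin.toFinset) fun x hx => ?_]
  · exact (ENNReal.sum_lt_top.2 fun x _ => ENNReal.mul_lt_top ENNReal.ofReal_lt_top
      (ENNReal.pow_lt_top enorm_lt_top)).ne
  · have : f (x : Space d) = 0 := by
      by_contra h0
      exact hx (hfin.mem_toFinset.2 (hn x (subset_tsupport _ h0)))
    rw [this, ENNReal.ofReal_zero, zero_mul]

/-- The diagonal elements of `A*A` are `‖A δ_y‖²`; this links the complex trace to the `ℝ≥0∞`-valued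
sums of the transport identity. -/
theorem tr_star_mul_self (A : Ω.OpFamily) {f : C_c(Space d, ℝ)} (hf : ∀ x, 0 ≤ f x) (ω : Ω.Pt) :
    tr ((star (A ω) * A ω) ∘L mulOp f ω.1) =
      ((pairSum A (fun _ y => ENNReal.ofReal (f y)) ω).toReal : ℂ) := by
  classical
  rw [tr_comp_mulOp, pairSum_right, ENNReal.tsum_toReal_eq fun x => ?_, Complex.ofReal_tsum]
  · refine tsum_congr fun x => ?_
    rw [ENNReal.toReal_mul, ENNReal.toReal_ofReal (hf x), ENNReal.toReal_pow, toReal_enorm,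
      Complex.ofReal_mul]
    congr 1
    rw [mul_apply_eq_comp, ContinuousLinearMap.star_eq_adjoint,
      ContinuousLinearMap.adjoint_inner_right, inner_self_eq_norm_sq_to_K]
    simp
  · exact ENNReal.mul_ne_top ENNReal.ofReal_ne_top (ENNReal.pow_ne_top enorm_ne_top)

variable (μ : Measure Ω.Pt)

theorem integrable_inner_of_bounded [IsFiniteMeasure μ] {A : Ω.OpFamily}
    (hA : A ∈ randomFamilies Ω) {g h : Ω.Section} (hg : Ω.MeasurableSection g)
    (hh : Ω.MeasurableSection h) {K L : ℝ} (hgK : ∀ ω, ‖g ω‖ ≤ K) (hhL : ∀ ω, ‖h ω‖ ≤ L) :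
    Integrable (fun ω => ⟪g ω, A ω (h ω)⟫_ℂ) μ := by
  obtain ⟨M, hM⟩ := hA.2.2
  refine Integrable.of_bound (hA.2.1 g h hg hh).aestronglyMeasurable (K * (M * L))
    (Eventually.of_forall fun ω => (norm_inner_le_norm _ _).trans ?_)
  refine mul_le_mul (hgK ω) (((A ω).le_opNorm _).trans ?_) (norm_nonneg _)
    ((norm_nonneg _).trans (hgK ω))
  exact mul_le_mul (hM ω) (hhL ω) (norm_nonneg _) ((norm_nonneg _).trans (hM ω))

theorem integrable_inner_cellSection [IsFiniteMeasure μ] {A : Ω.OpFamily}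
    (hA : A ∈ randomFamilies Ω) (f : C_c(Space d, ℝ)) (i : ℕ) :
    Integrable (fun ω => ⟪(cellSection (sqrtFun f) i : Ω.Section) ω,
      A ω ((cellSection (sqrtFun f) i : Ω.Section) ω)⟫_ℂ) μ := by
  obtain ⟨K, hK⟩ := exists_norm_sqrtFun_le f
  have hm : Ω.MeasurableSection (cellSection (sqrtFun f) i) :=
    measurableSection_cellSection (measurable_sqrtFun f) i
  exact integrable_inner_of_bounded μ hA hm hm (norm_cellSection_le hK i) (norm_cellSection_le hK i)

theorem integrable_tr [IsFiniteMeasure μ] {A : Ω.OpFamily} (hA : A ∈ randomFamilies Ω)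
    {f : C_c(Space d, ℝ)} (hf : ∀ x, 0 ≤ f x) :
    Integrable (fun ω : Ω.Pt => tr (A ω ∘L mulOp f ω.1)) μ := by
  obtain ⟨n, -, hn⟩ := exists_tr_eq_sum Ω hf
  simp_rw [hn]
  exact integrable_finsetSum _ fun i _ => integrable_inner_cellSection μ hA f i

/-- The integral `∫ tr(A_ω M_f) dμ(ω)`, as a linear functional of the family `A`. -/
def traceIntegral [IsFiniteMeasure μ] {f : C_c(Space d, ℝ)} (hf : ∀ x, 0 ≤ f x) :
    randomFamilies Ω →ₗ[ℂ] ℂ where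
  toFun A := ∫ ω : Ω.Pt, tr (A.1 ω ∘L mulOp f ω.1) ∂μ
  map_add' A B := by
    rw [← integral_add (integrable_tr μ A.2 hf) (integrable_tr μ B.2 hf)]
    obtain ⟨n, -, hn⟩ := exists_tr_eq_sum Ω hf
    refine integral_congr_ae (Eventually.of_forall fun ω => ?_)
    simp only [hn, ← Finset.sum_add_distrib]
    exact Finset.sum_congr rfl fun i _ => inner_add_right _ _ _
  map_smul' c A := by
    rw [RingHom.id_apply, smul_eq_mul, ← integral_const_mul]
    obtain ⟨n, -, hn⟩ := exists_tr_eq_sum Ω hf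
    refine integral_congr_ae (Eventually.of_forall fun ω => ?_)
    simp only [hn, Finset.mul_sum]
    exact Finset.sum_congr rfl fun i _ => inner_smul_right _ _ _

variable [IsFiniteMeasure μ]

theorem traceIntegral_star_mul_self (A : randomFamilies Ω) {f : C_c(Space d, ℝ)}
    (hf : ∀ x, 0 ≤ f x) : traceIntegral μ hf (star A * A) =
      ((∫⁻ ω, pairSum A.1 (fun _ y => ENNReal.ofReal (f y)) ω ∂μ).toReal : ℂ) := by
  have hm : Measurable fun ω => pairSum A.1 (fun _ y => ENNReal.ofReal (f y)) ω :=
    (measurable_pairSum (T := Unit) (w := fun _ _ y => ENNReal.ofReal (f y)) A.2.2.1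
      (f.continuous.measurable.ennreal_ofReal.comp (by fun_prop))).comp
        (measurable_const (a := ()).prodMk measurable_id)
  rw [← integral_toReal hm.aemeasurable
    (Eventually.of_forall fun ω => (pairSum_ne_top A.1 f ω).lt_top), ← integral_complex_ofReal]
  exact integral_congr_ae (Eventually.of_forall fun ω => tr_star_mul_self A.1 hf ω)

variable [VAddInvariantMeasure (Space d) Ω.Pt μ]

theorem traceIntegral_star_mul_self_comm (A : randomFamilies Ω) {f g : C_c(Space d, ℝ)}
    (hf : IsNormalized f) (hg : IsNormalized g) :
    traceIntegral μ hf.1 (star A * A) = traceIntegral μ hg.1 (A * star A) := by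
  have h := traceIntegral_star_mul_self μ (star A) hg.1
  rw [star_star] at h
  rw [h, traceIntegral_star_mul_self μ A hf.1,
    ← lintegral_pairSum_eq μ A.2 hg hf]
  congr 2
  refine lintegral_congr fun ω => ?_
  rw [pairSum_left, pairSum_right]
  rfl

theorem traceIntegral_mul_comm (A B : randomFamilies Ω) {f g : C_c(Space d, ℝ)}
    (hf : IsNormalized f) (hg : IsNormalized g) :
    traceIntegral μ hf.1 (A * B) = traceIntegral μ hg.1 (B * A) := by
  -- The defect `τ_f(C*C) - τ_g(CC*)` is a quadratic form in `C` that vanishes identically; its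
  -- values at `B`, `A*`, `B + A*` and `B + iA*` isolate `τ_f(AB) - τ_g(BA)`.
  have key : ∀ C : randomFamilies Ω,
      traceIntegral μ hf.1 (star C * C) - traceIntegral μ hg.1 (C * star C) = 0 := fun C =>
    sub_eq_zero.2 (traceIntegral_star_mul_self_comm μ C hf hg)
  have h0 := key B
  have h1 := key (star A)
  have h2 := key (B + star A)
  have h3 := key (B + Complex.I • star A)
  simp only [star_add, star_smul, star_star, mul_add, add_mul, smul_mul_assoc, mul_smul_comm,
    map_add, map_smul, smul_eq_mul, RCLike.star_def, Complex.conj_I] at h0 h1 h2 h3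
  -- The first line is the polarization; the multiple of `Complex.I_mul_I` only accounts for the
  -- occurrences of `i² = -1`.
  linear_combination (1 / 2 : ℂ) * (h2 - h0 - h1) + (Complex.I / 2) * (h3 - h0 - h1) +
    (1 / 2 * (traceIntegral μ hf.1 (A * B) - traceIntegral μ hf.1 (star B * star A)
      - traceIntegral μ hg.1 (B * A) + traceIntegral μ hg.1 (star A * star B))
      + Complex.I / 2 * (traceIntegral μ hf.1 (A * star A) - traceIntegral μ hg.1 (star A * A))) *
    Complex.I_mul_I

end TraceIntegral

end DeloneSystem
end Delone

namespace Delone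

open scoped BoundedContinuousFunction

/-! ### Borel functions of a bounded selfadjoint operator. -/

section BorelCalculus
variable {H : Type*} [NormedAddCommGroup H] [InnerProductSpace ℂ H]

section Polarization

/-- The polarization of a function `q`. -/
def polarization (q : H → ℂ) (x y : H) : ℂ :=
  (1 / 4) * (q (x + y) - q (x - y) - Complex.I * q (x + Complex.I • y) +
    Complex.I * q (x - Complex.I • y))

theorem polarization_inner (S : H →L[ℂ] H) (x y : H) :
    polarization (fun v => ⟪v, S v⟫_ℂ) x y = ⟪x, S y⟫_ℂ := by
  simp only [polarization, map_add, map_sub, map_smul, inner_add_left, inner_add_right,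
    inner_sub_left, inner_sub_right, inner_smul_left, inner_smul_right, Complex.conj_I]
  linear_combination (-1 / 2 * ⟪x, S y⟫_ℂ + 1 / 2 * ⟪y, S x⟫_ℂ) * Complex.I_mul_I

/-- The formal counterpart of `polarization`. -/
def formalPolarization (x y : H) : H →₀ ℂ :=
  (1 / 4 : ℂ) • (Finsupp.single (x + y) 1 - Finsupp.single (x - y) 1
    - Complex.I • Finsupp.single (x + Complex.I • y) 1 +
    Complex.I • Finsupp.single (x - Complex.I • y) 1)

theorem linearCombination_formalPolarization (q : H → ℂ) (x y : H) :
    Finsupp.linearCombination ℂ q (formalPolarization x y) = polarization q x y := by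
  simp only [formalPolarization, polarization, map_smul, map_add, map_sub,
    Finsupp.linearCombination_single, smul_eq_mul, one_mul]

theorem eq_of_forall_inner_self_eq {S S' : H →L[ℂ] H} (h : ∀ x, ⟪x, S x⟫_ℂ = ⟪x, S' x⟫_ℂ) :
    S = S' := by
  ext y
  refine ext_inner_left ℂ fun x => ?_
  rw [← polarization_inner S, ← polarization_inner S']
  simp_rw [h]

end Polarization

variable [CompleteSpace H]

section ScalarMeasure

theorem inner_apply_self_of_isSelfAdjoint {S : H →L[ℂ] H} (hS : IsSelfAdjoint S) (x : H) :
    ((⟪x, S x⟫_ℂ).re : ℂ) = ⟪x, S x⟫_ℂ := by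
  refine Complex.conj_eq_iff_re.1 ?_
  rw [inner_conj_symm, ← ContinuousLinearMap.adjoint_inner_right,
    ← ContinuousLinearMap.star_eq_adjoint, hS.star_eq]

theorem re_inner_cfcHom_nonneg {T : H →L[ℂ] H} (hT : IsSelfAdjoint T) {g : C(spectrum ℝ T, ℝ)}
    (hg : 0 ≤ g) (x : H) : 0 ≤ (⟪x, cfcHom hT g x⟫_ℂ).re :=
  ((ContinuousLinearMap.nonneg_iff_isPositive _).1
    ((cfcHom_nonneg_iff hT).2 hg)).re_inner_nonneg_right x

/-- Existence of the spectral measures, which live on the spectrum. -/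
theorem exists_isSpectralMeasureAt {T : H →L[ℂ] H} (hT : IsSelfAdjoint T) (x : H) :
    ∃ m : Measure ℝ, IsSpectralMeasureAt T x m ∧ m (spectrum ℝ T)ᶜ = 0 := by
  have hc : IsCompact (spectrum ℝ T) := ContinuousFunctionalCalculus.isCompact_spectrum T
  have : CompactSpace (spectrum ℝ T) := isCompact_iff_compactSpace.1 hc
  -- The functional `g ↦ ⟨x, g(T) x⟩` is positive on the compact spectrum; its Riesz–Markov–Kakutani
  -- measure, pushed forward to `ℝ`, is the spectral measure.
  let Λ : C_c(spectrum ℝ T, ℝ) →ₚ[ℝ] ℝ :=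
    { toFun := fun g => (⟪x, cfcHom hT g.toContinuousMap x⟫_ℂ).re
      map_add' := fun g h => by
        have : (g + h).toContinuousMap = g.toContinuousMap + h.toContinuousMap := rfl
        rw [this, map_add, add_apply, inner_add_right, Complex.add_re]
      map_smul' := fun c g => by
        have : (c • g).toContinuousMap = c • g.toContinuousMap := rfl
        rw [this, map_smul, smul_apply, ← Complex.coe_smul, inner_smul_right,
          Complex.re_ofReal_mul]
        rfl
      monotone' := fun g h hgh => by
        have h0 : 0 ≤ h.toContinuousMap - g.toContinuousMap := sub_nonneg.2 fun t => hgh t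
        have := re_inner_cfcHom_nonneg hT h0 x
        rw [map_sub, sub_apply, inner_sub_right, Complex.sub_re] at this
        exact sub_nonneg.1 this }
  let ν := RealRMK.rieszMeasure Λ
  refine ⟨ν.map Subtype.val, ⟨inferInstance, fun g => ?_⟩, ?_⟩
  · rw [integral_map (by fun_prop) (by fun_prop)]
    let g' : C_c(spectrum ℝ T, ℝ) :=
      { toFun := fun t => g t
        hasCompactSupport' := HasCompactSupport.of_compactSpace _ }
    have h1 : ∫ t, g' t ∂ν = Λ g' := RealRMK.integral_rieszMeasure Λ g'
    have h2 : cfcHom hT g'.toContinuousMap = cfc (g : ℝ → ℝ) T :=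
      (cfc_apply (g : ℝ → ℝ) T hT g.continuous.continuousOn).symm
    have h3 : Λ g' = (⟪x, cfc (g : ℝ → ℝ) T x⟫_ℂ).re := by
      rw [← h2]
      rfl
    change ((∫ t, g' t ∂ν : ℝ) : ℂ) = _
    rw [h1, h3, inner_apply_self_of_isSelfAdjoint (cfc_predicate _ _)]
  · rw [Measure.map_apply (by fun_prop) hc.measurableSet.compl]
    simp

theorem IsSpectralMeasureAt.unique {T : H →L[ℂ] H} {x : H} {m m' : Measure ℝ}
    (h : IsSpectralMeasureAt T x m) (h' : IsSpectralMeasureAt T x m') : m = m' := by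
  have := h.1
  have := h'.1
  refine ext_of_forall_integral_eq_of_IsFiniteMeasure fun g => ?_
  exact_mod_cast (h.2 g).trans (h'.2 g).symm

theorem IsSpectralMeasureAt.measure_compl_spectrum {T : H →L[ℂ] H} (hT : IsSelfAdjoint T) {x : H}
    {m : Measure ℝ} (h : IsSpectralMeasureAt T x m) : m (spectrum ℝ T)ᶜ = 0 := by
  obtain ⟨m', hm', h0⟩ := exists_isSpectralMeasureAt hT x
  rwa [h.unique hm']

theorem IsSpectralMeasureAt.measureReal_univ {T : H →L[ℂ] H} (hT : IsSelfAdjoint T) {x : H}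
    {m : Measure ℝ} (h : IsSpectralMeasureAt T x m) : m.real univ = ‖x‖ ^ 2 := by
  have h1 := h.2 1
  have h2 : cfc ((1 : ℝ →ᵇ ℝ) : ℝ → ℝ) T = 1 := cfc_one ℝ T
  rw [h2, one_apply_eq_self, inner_self_eq_norm_sq_to_K] at h1
  simp only [BoundedContinuousFunction.coe_one, Pi.one_apply, integral_const, smul_eq_mul,
    mul_one] at h1
  exact Complex.ofReal_injective (h1.trans (by norm_cast))

theorem IsSpectralMeasureAt.norm_integral_le {T : H →L[ℂ] H} (hT : IsSelfAdjoint T) {x : H}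
    {m : Measure ℝ} (h : IsSpectralMeasureAt T x m) {F : ℝ → ℂ} {K : ℝ} (hK : ∀ t, ‖F t‖ ≤ K) :
    ‖∫ t, F t ∂m‖ ≤ K * ‖x‖ ^ 2 := by
  have := h.1
  rw [← h.measureReal_univ hT]
  exact norm_integral_le_of_norm_le_const (Eventually.of_forall hK)

/-- Complex bounded continuous functions of a selfadjoint operator. -/
theorem IsSpectralMeasureAt.integral_complex {T : H →L[ℂ] H} {x : H}
    {m : Measure ℝ} (h : IsSpectralMeasureAt T x m) (g : ℝ →ᵇ ℂ) :
    ∫ t, g t ∂m = ⟪x, (cfc (fun t => (g t).re) T + Complex.I • cfc (fun t => (g t).im) T) x⟫_ℂ := by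
  have := h.1
  have h1 := h.2 (Complex.reCLM.compLeftContinuousBounded ℝ g)
  have h2 := h.2 (Complex.imCLM.compLeftContinuousBounded ℝ g)
  have hg : Integrable (fun t => g t) m := g.integrable m
  rw [add_apply, smul_apply, inner_add_right, inner_smul_right]
  have e1 : ((Complex.reCLM.compLeftContinuousBounded ℝ g : ℝ →ᵇ ℝ) : ℝ → ℝ) =
    fun t => (g t).re := rfl
  have e2 : ((Complex.imCLM.compLeftContinuousBounded ℝ g : ℝ →ᵇ ℝ) : ℝ → ℝ) =
    fun t => (g t).im := rfl
  rw [e1] at h1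
  rw [e2] at h2
  rw [← h1, ← h2, ← integral_re_add_im hg, mul_comm Complex.I]
  rfl

end ScalarMeasure

section QuadraticForm

/-- A bounded function which satisfies all the linear relations satisfied by the quadratic forms of
bounded operators is the quadratic form of a bounded operator. -/
theorem exists_operator_of_quadratic {q : H → ℂ} {K : ℝ} (hK0 : 0 ≤ K)
    (hK : ∀ v, ‖q v‖ ≤ K * ‖v‖ ^ 2)
    (hq : ∀ a : H →₀ ℂ, (∀ S : H →L[ℂ] H,
      Finsupp.linearCombination ℂ (fun v => ⟪v, S v⟫_ℂ) a = 0) →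
      Finsupp.linearCombination ℂ q a = 0) :
    ∃ S : H →L[ℂ] H, ‖S‖ ≤ 4 * K ∧ ∀ v, ⟪v, S v⟫_ℂ = q v := by
  -- Each sesquilinearity law for `polarization q` is a finite linear relation between values of
  -- `q`, encoded by a formal combination. It holds for all `v ↦ ⟨v, S v⟩`, so `hq` transfers it to
  -- `q`.
  have h_add_left : ∀ x y z, polarization q (x + y) z = polarization q x z + polarization q y z := by
    intro x y z
    have := hq (formalPolarization (x + y) z - (formalPolarization x z + formalPolarization y z))
      fun S => by
        simp only [map_sub, map_add, linearCombination_formalPolarization, polarization_inner,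
          inner_add_left, sub_self]
    simpa only [map_sub, map_add, linearCombination_formalPolarization, sub_eq_zero] using this
  have h_add_right : ∀ x y z,
      polarization q x (y + z) = polarization q x y + polarization q x z := by
    intro x y z
    have := hq (formalPolarization x (y + z) - (formalPolarization x y + formalPolarization x z))
      fun S => by
        simp only [map_sub, map_add, linearCombination_formalPolarization, polarization_inner,
          inner_add_right, sub_self]
    simpa only [map_sub, map_add, linearCombination_formalPolarization, sub_eq_zero] using this
  have h_smul_left : ∀ (c : ℂ) x y,
      polarization q (c • x) y = (starRingEnd ℂ) c • polarization q x y := by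
    intro c x y
    have := hq (formalPolarization (c • x) y - (starRingEnd ℂ) c • formalPolarization x y)
      fun S => by
        simp only [map_sub, map_smul, linearCombination_formalPolarization, polarization_inner,
          inner_smul_left, smul_eq_mul, sub_self]
    simpa only [map_sub, map_smul, linearCombination_formalPolarization, sub_eq_zero] using this
  have h_smul_right : ∀ (c : ℂ) x y, polarization q x (c • y) = c • polarization q x y := by
    intro c x y
    have := hq (formalPolarization x (c • y) - c • formalPolarization x y)
      fun S => by
        simp only [map_sub, map_smul, linearCombination_formalPolarization, polarization_inner,
          inner_smul_right, smul_eq_mul, sub_self]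
    simpa only [map_sub, map_smul, linearCombination_formalPolarization, sub_eq_zero] using this
  have h_self : ∀ x, polarization q x x = q x := by
    intro x
    have := hq (formalPolarization x x - Finsupp.single x 1)
      fun S => by
        simp only [map_sub, linearCombination_formalPolarization, polarization_inner,
          Finsupp.linearCombination_single, one_smul, sub_self]
    simpa only [map_sub, linearCombination_formalPolarization, Finsupp.linearCombination_single,
      one_smul, sub_eq_zero] using this
  have h_unit : ∀ x y, ‖x‖ ≤ 1 → ‖y‖ ≤ 1 → ‖polarization q x y‖ ≤ 4 * K := by
    intro x y hx hy
    -- The four vectors in the polarization of unit-ball vectors have norm at most `2`; four such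
    -- values with weight `1/4` give the bound `4 * K`.
    have h4 : ∀ v, ‖v‖ ≤ 2 → ‖q v‖ ≤ 4 * K := fun v hv => by
      refine (hK v).trans ?_
      nlinarith [mul_le_mul_of_nonneg_left (pow_le_pow_left₀ (norm_nonneg v) hv 2) hK0]
    have hI : ‖Complex.I • y‖ ≤ 1 := by rwa [norm_smul, Complex.norm_I, one_mul]
    have h1 := h4 (x + y) ((norm_add_le _ _).trans (by linarith))
    have h2 := h4 (x - y) ((norm_sub_le _ _).trans (by linarith))
    have h3 := h4 (x + Complex.I • y) ((norm_add_le _ _).trans (by linarith))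
    have h5 := h4 (x - Complex.I • y) ((norm_sub_le _ _).trans (by linarith))
    rw [polarization, norm_mul]
    have e : ‖(1 / 4 : ℂ)‖ = 1 / 4 := by norm_num
    have h6 := norm_add_le (q (x + y) - q (x - y) - Complex.I * q (x + Complex.I • y))
      (Complex.I * q (x - Complex.I • y))
    have h7 := norm_sub_le (q (x + y) - q (x - y)) (Complex.I * q (x + Complex.I • y))
    have h8 := norm_sub_le (q (x + y)) (q (x - y))
    rw [norm_mul, Complex.norm_I, one_mul] at h6 h7
    rw [e]
    linarith
  have h_bound : ∀ x y, ‖polarization q x y‖ ≤ 4 * K * ‖x‖ * ‖y‖ := by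
    intro x y
    have hn : ∀ z : H, ((‖z‖ : ℂ)) • (((‖z‖⁻¹ : ℝ) : ℂ) • z) = z := fun z => by
      by_cases hz : z = 0
      · simp [hz]
      · rw [smul_smul, Complex.ofReal_inv, mul_inv_cancel₀ (by simpa using hz), one_smul]
    have hu : ∀ z : H, ‖((‖z‖⁻¹ : ℝ) : ℂ) • z‖ ≤ 1 := fun z => by
      rw [norm_smul, Complex.norm_real, norm_inv, norm_norm]
      exact inv_mul_le_one
    rw [← hn x, ← hn y, h_smul_left, h_smul_right, hn, hn, norm_smul, norm_smul]
    have := h_unit _ _ (hu x) (hu y)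
    simp only [RCLike.norm_conj, Complex.norm_real, norm_norm]
    nlinarith [mul_le_mul_of_nonneg_left this (mul_nonneg (norm_nonneg x) (norm_nonneg y))]
  let B := LinearMap.mkContinuous₂ (LinearMap.mk₂'ₛₗ (starRingEnd ℂ) (RingHom.id ℂ)
    (polarization q) h_add_left h_smul_left h_add_right h_smul_right) (4 * K) h_bound
  have hB : ∀ x y, B x y = polarization q x y := fun x y => rfl
  -- The Riesz operator represents the form in the left slot of the inner product; the adjoint moves
  -- it to the right slot.
  refine ⟨star (InnerProductSpace.continuousLinearMapOfBilin B), ?_, fun v => ?_⟩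
  · rw [norm_star]
    refine ContinuousLinearMap.opNorm_le_bound _ (by linarith) fun x => ?_
    set y := InnerProductSpace.continuousLinearMapOfBilin B x with hy
    by_cases h0 : ‖y‖ = 0
    · rw [h0]
      positivity
    · have h1 : ‖y‖ ^ 2 = ‖B x y‖ := by
        rw [← InnerProductSpace.continuousLinearMapOfBilin_apply, ← hy,
          inner_self_eq_norm_sq_to_K]
        simp
      have h2 : ‖y‖ * ‖y‖ ≤ 4 * K * ‖x‖ * ‖y‖ := by
        rw [← pow_two, h1, hB]
        exact h_bound x y
      exact le_of_mul_le_mul_right h2 (lt_of_le_of_ne (norm_nonneg y) (Ne.symm h0))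
  · rw [ContinuousLinearMap.star_eq_adjoint, ContinuousLinearMap.adjoint_inner_right,
      InnerProductSpace.continuousLinearMapOfBilin_apply, hB, h_self]

end QuadraticForm

section BorelFunction

/-- Linear relations between the quadratic forms of bounded operators persist for integrals of
bounded Borel functions against the spectral measures. -/
theorem linearCombination_integral_eq_zero {T : H →L[ℂ] H} {m : H → Measure ℝ}
    (hm : ∀ x, IsSpectralMeasureAt T x (m x)) {F : ℝ → ℂ} (hF : Measurable F) {K : ℝ}
    (hK : ∀ t, ‖F t‖ ≤ K) (a : H →₀ ℂ)
    (ha : ∀ S : H →L[ℂ] H, Finsupp.linearCombination ℂ (fun v => ⟪v, S v⟫_ℂ) a = 0) :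
    Finsupp.linearCombination ℂ (fun v => ∫ t, F t ∂m v) a = 0 := by
  have hfin : ∀ x, IsFiniteMeasure (m x) := fun x => (hm x).1
  have hFint : ∀ (ν : Measure ℝ) [IsFiniteMeasure ν], Integrable F ν := fun ν _ =>
    Integrable.of_bound hF.aestronglyMeasurable K (Eventually.of_forall hK)
  -- `M` dominates the finitely many spectral measures involved, so a single continuous `g` close to
  -- `F` in `L¹(M)` is close in all of them at once.
  let M : Measure ℝ := ∑ v ∈ a.support, m v
  have hM : ∀ v ∈ a.support, m v ≤ M := fun v hv => Measure.le_iff.2 fun s _ => by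
    rw [Measure.finsetSum_apply]
    exact Finset.single_le_sum (f := fun v => m v s) (fun _ _ => zero_le) hv
  have key : ∀ ε : ℝ, 0 < ε → ‖Finsupp.linearCombination ℂ (fun v => ∫ t, F t ∂m v) a‖ ≤
      (∑ v ∈ a.support, ‖a v‖) * ε := by
    intro ε hε
    obtain ⟨g, hg, hgi⟩ := (hFint M).exists_boundedContinuous_integral_sub_le hε
    have h0 := ha (cfc (fun t => (g t).re) T + Complex.I • cfc (fun t => (g t).im) T)
    have h1 : Finsupp.linearCombination ℂ (fun v => ∫ t, g t ∂m v) a = 0 := by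
      rw [← h0]
      congr 1
      congr 1
      funext v
      exact (hm v).integral_complex g
    rw [← sub_zero (Finsupp.linearCombination ℂ _ a), ← h1]
    simp only [Finsupp.linearCombination_apply, Finsupp.sum]
    rw [← Finset.sum_sub_distrib, Finset.sum_mul]
    refine (norm_sum_le _ _).trans (Finset.sum_le_sum fun v hv => ?_)
    rw [← smul_sub, norm_smul]
    refine mul_le_mul_of_nonneg_left ?_ (norm_nonneg _)
    rw [← integral_sub (hFint _) (g.integrable _)]
    refine (norm_integral_le_integral_norm _).trans (le_trans ?_ hg)
    exact integral_mono_measure (hM v hv) (Eventually.of_forall fun _ => norm_nonneg _)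
      ((hFint M).sub hgi).norm
  refine norm_eq_zero.1 (le_antisymm (le_of_forall_pos_le_add fun δ hδ => ?_) (norm_nonneg _))
  set s := ∑ v ∈ a.support, ‖a v‖
  have hs : 0 ≤ s := Finset.sum_nonneg fun _ _ => norm_nonneg _
  -- The `+ 1` avoids dividing by zero when all coefficients vanish.
  refine (key (δ / (s + 1)) (by positivity)).trans ?_
  rw [zero_add, mul_div_assoc', div_le_iff₀ (by positivity)]
  nlinarith

theorem exists_isBorelFunctionOf {T : H →L[ℂ] H} (hT : IsSelfAdjoint T) {F : ℝ → ℂ}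
    (hF : Measurable F) {K : ℝ} (hK : ∀ t, ‖F t‖ ≤ K) :
    ∃ S : H →L[ℂ] H, ‖S‖ ≤ 4 * K ∧ IsBorelFunctionOf T F S := by
  choose m hm _ using fun x => exists_isSpectralMeasureAt hT x
  obtain ⟨S, hS, h⟩ := exists_operator_of_quadratic (q := fun x => ∫ t, F t ∂m x)
    ((norm_nonneg _).trans (hK 0)) (fun v => (hm v).norm_integral_le hT hK)
    fun a ha => linearCombination_integral_eq_zero hm hF hK a ha
  exact ⟨S, hS, fun x => ⟨m x, hm x, h x⟩⟩

theorem IsBorelFunctionOf.inner_eq {T S : H →L[ℂ] H} {F : ℝ → ℂ} (h : IsBorelFunctionOf T F S)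
    {x : H} {m : Measure ℝ} (hm : IsSpectralMeasureAt T x m) : ⟪x, S x⟫_ℂ = ∫ t, F t ∂m := by
  obtain ⟨m', hm', h'⟩ := h x
  rw [h', hm'.unique hm]

theorem IsBorelFunctionOf.unique {T S S' : H →L[ℂ] H} {F : ℝ → ℂ} (h : IsBorelFunctionOf T F S)
    (h' : IsBorelFunctionOf T F S') : S = S' := by
  refine eq_of_forall_inner_self_eq fun x => ?_
  obtain ⟨m, hm, e⟩ := h x
  rw [e, h'.inner_eq hm]

theorem eq_zero_of_forall_spectralMeasure {T S : H →L[ℂ] H} {B : Set ℝ} (hB : MeasurableSet B)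
    (h : IsBorelFunctionOf T (B.indicator fun _ => 1) S) :
    S = 0 ↔ ∀ x m, IsSpectralMeasureAt T x m → m B = 0 := by
  have key : ∀ x m, IsSpectralMeasureAt T x m → ⟪x, S x⟫_ℂ = (m.real B : ℂ) := fun x m hm => by
    rw [h.inner_eq hm, integral_indicator_const _ hB]
    simp
  constructor
  · intro hS x m hm
    have := hm.1
    have h1 := key x m hm
    rw [hS, zero_apply, inner_zero_right] at h1
    have h2 : m.real B = 0 := by exact_mod_cast h1.symm
    exact (measureReal_eq_zero_iff).1 h2
  · intro hz
    refine eq_of_forall_inner_self_eq fun x => ?_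
    obtain ⟨m, hm, -⟩ := h x
    rw [key x m hm, measureReal_def, hz x m hm]
    simp

theorem isPositive_of_indicator {T S : H →L[ℂ] H} {B : Set ℝ} (hB : MeasurableSet B)
    (h : IsBorelFunctionOf T (B.indicator fun _ => 1) S) : S.IsPositive := by
  have key : ∀ x, ∃ c : ℝ, 0 ≤ c ∧ ⟪x, S x⟫_ℂ = c := fun x => by
    obtain ⟨m, -, e⟩ := h x
    refine ⟨m.real B, measureReal_nonneg, ?_⟩
    rw [e, integral_indicator_const _ hB]
    simp
  rw [ContinuousLinearMap.isPositive_iff_complex]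
  intro x
  obtain ⟨c, hc, e⟩ := key x
  have e' : ⟪S x, x⟫_ℂ = c := by rw [← inner_conj_symm, e, Complex.conj_ofReal]
  rw [e']
  simpa using hc

/-- A spectral projection of an open set vanishes exactly if the set does not meet the spectrum. -/
theorem eq_zero_iff_disjoint_spectrum {T S : H →L[ℂ] H} (hT : IsSelfAdjoint T)
    {U : Set ℝ} (hU : IsOpen U) (h : IsBorelFunctionOf T (U.indicator fun _ => 1) S) :
    S = 0 ↔ Disjoint (spectrum ℝ T) U := by
  rw [eq_zero_of_forall_spectralMeasure hU.measurableSet h]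
  constructor
  · intro hz
    rw [Set.disjoint_left]
    intro t ht htU
    -- On the zero space the spectrum is empty; nontriviality is what gives `σ(0) = {0}` below.
    have hT' : Nontrivial H := by
      by_contra hH
      rw [not_nontrivial_iff_subsingleton] at hH
      have : Subsingleton (H →L[ℂ] H) := inferInstance
      rw [spectrum.of_subsingleton] at ht
      exact ht
    -- A Urysohn function with `g(t) = 1` and `g = 0` off `U`. No spectral measure charges `U`, so
    -- `g(T) = 0`, while spectral mapping puts `g(t) = 1` into `σ(g(T)) = {0}`.
    obtain ⟨g, hgU, hgt, hg01⟩ := exists_continuous_zero_one_of_isClosed (s := Uᶜ) (t := {t})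
      hU.isClosed_compl isClosed_singleton (Set.disjoint_singleton_right.2 fun hn => hn htU)
    let g' : ℝ →ᵇ ℝ := BoundedContinuousFunction.ofNormedAddCommGroup g g.continuous 1 fun s => by
      rw [Real.norm_of_nonneg (hg01 s).1]
      exact (hg01 s).2
    have h0 : cfc (g' : ℝ → ℝ) T = 0 := by
      refine eq_of_forall_inner_self_eq fun x => ?_
      obtain ⟨m, hm, -⟩ := exists_isSpectralMeasureAt hT x
      have hae : (fun s => g' s) =ᵐ[m] 0 := by
        have : ∀ᵐ s ∂m, s ∉ U := by
          rw [ae_iff]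
          simpa using hz x m hm
        filter_upwards [this] with s hs
        exact hgU hs
      rw [← hm.2 g', integral_congr_ae hae]
      simp
    have h1 := cfc_map_spectrum (g' : ℝ → ℝ) T hT g'.continuous.continuousOn
    rw [h0, spectrum.zero_eq] at h1
    have h2 : g' t ∈ ({0} : Set ℝ) := h1 ▸ mem_image_of_mem _ ht
    have h3 : g' t = 1 := hgt rfl
    rw [h3] at h2
    exact one_ne_zero h2
  · intro hd x m hm
    exact measure_mono_null (Set.disjoint_left.1 hd.symm : U ⊆ (spectrum ℝ T)ᶜ)
      (hm.measure_compl_spectrum hT)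

variable {H' : Type*} [NormedAddCommGroup H'] [InnerProductSpace ℂ H'] [CompleteSpace H']

/-- Conjugation by a unitary is a continuous `*`-isomorphism, so it commutes with the continuous
functional calculus. -/
theorem IsSpectralMeasureAt.conj {T : H →L[ℂ] H} (hT : IsSelfAdjoint T) {x : H} {m : Measure ℝ}
    (h : IsSpectralMeasureAt T x m) (U : H ≃ₗᵢ[ℂ] H') :
    IsSpectralMeasureAt (U.conjStarAlgEquiv T) (U x) m := by
  refine ⟨h.1, fun g => ?_⟩
  have h1 : U.conjStarAlgEquiv (cfc (g : ℝ → ℝ) T) = cfc (g : ℝ → ℝ) (U.conjStarAlgEquiv T) :=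
    StarAlgHomClass.map_cfc (S := ℂ) U.conjStarAlgEquiv (g : ℝ → ℝ) T
      g.continuous.continuousOn ?_ hT (hT.map _)
  · rw [← h1, LinearIsometryEquiv.conjStarAlgEquiv_apply_apply,
      LinearIsometryEquiv.symm_apply_apply, LinearIsometryEquiv.inner_map_map]
    exact h.2 g
  · exact (StarAlgEquiv.isometry U.conjStarAlgEquiv).continuous

theorem IsBorelFunctionOf.conj {T S : H →L[ℂ] H} (hT : IsSelfAdjoint T) {F : ℝ → ℂ}
    (h : IsBorelFunctionOf T F S) (U : H ≃ₗᵢ[ℂ] H') :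
    IsBorelFunctionOf (U.conjStarAlgEquiv T) F (U.conjStarAlgEquiv S) := by
  intro y
  obtain ⟨m, hm, e⟩ := h (U.symm y)
  refine ⟨m, ?_, ?_⟩
  · have := hm.conj hT U
    rwa [LinearIsometryEquiv.apply_symm_apply] at this
  · rw [← e, LinearIsometryEquiv.conjStarAlgEquiv_apply_apply, ← U.symm.inner_map_map,
      LinearIsometryEquiv.symm_apply_apply]

end BorelFunction

end BorelCalculus
end Delone

namespace Delone

/-! ### Measurable families of spectral measures. -/

open ProbabilityTheory

theorem measurable_integral_of_bounded {α : Type*} [MeasurableSpace α] {m : α → Measure ℝ}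
    (hm : Measurable m) (hfin : ∀ a, IsFiniteMeasure (m a)) {F : ℝ → ℂ} (hF : Measurable F) {K : ℝ}
    (hK : ∀ t, ‖F t‖ ≤ K) : Measurable fun a => ∫ t, F t ∂m a := by
  have hint : ∀ a, Integrable F (m a) := fun a =>
    Integrable.of_bound hF.aestronglyMeasurable K (Eventually.of_forall hK)
  have hreal : ∀ G : ℝ → ℝ, Measurable G → (∀ a, Integrable G (m a)) →
      Measurable fun a => ∫ t, G t ∂m a := fun G hG hGi => by
    simp_rw [fun a => integral_eq_lintegral_pos_part_sub_lintegral_neg_part (hGi a)]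
    exact (((Measure.measurable_lintegral hG.ennreal_ofReal).comp hm).ennreal_toReal).sub
      (((Measure.measurable_lintegral hG.neg.ennreal_ofReal).comp hm).ennreal_toReal)
  have e : ∀ a, ∫ t, F t ∂m a =
      ((∫ t, (F t).re ∂m a : ℝ) : ℂ) + ((∫ t, (F t).im ∂m a : ℝ) : ℂ) * Complex.I := fun a =>
    (integral_re_add_im (hint a)).symm
  simp_rw [e]
  exact (Complex.measurable_ofReal.comp (hreal _ (Complex.measurable_re.comp hF)
    fun a => (hint a).re)).add ((Complex.measurable_ofReal.comp
      (hreal _ (Complex.measurable_im.comp hF) fun a => (hint a).im)).mul_const _)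

/-- The mixture is the second marginal of `μ ⊗ₘ κ` for a finite kernel `κ`, so this is Fubini. -/
theorem integral_bind_of_bounded {α : Type*} [MeasurableSpace α] (μ : Measure α) [IsFiniteMeasure μ]
    {m : α → Measure ℝ} (hm : Measurable m) {C : ℝ≥0∞} (hC : C ≠ ∞) (hmC : ∀ a, m a univ ≤ C)
    {F : ℝ → ℂ} (hF : Measurable F) {K : ℝ} (hK : ∀ t, ‖F t‖ ≤ K) :
    IsFiniteMeasure (μ.bind m) ∧ ∫ t, F t ∂(μ.bind m) = ∫ a, ∫ t, F t ∂m a ∂μ := by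
  let κ : Kernel α ℝ := ⟨m, hm⟩
  have : IsFiniteKernel κ := ⟨⟨C, hC.lt_top, hmC⟩⟩
  have h : μ.bind m = (μ ⊗ₘ κ).snd := (Measure.snd_compProd μ κ).symm
  refine ⟨h ▸ inferInstance, ?_⟩
  have hi : Integrable (fun p : α × ℝ => F p.2) (μ ⊗ₘ κ) :=
    Integrable.of_bound (hF.comp measurable_snd).aestronglyMeasurable K
      (Eventually.of_forall fun p => hK p.2)
  rw [h, Measure.snd, integral_map measurable_snd.aemeasurable hF.aestronglyMeasurable,
    Measure.integral_compProd hi]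
  rfl

section ContinuousFunction
variable {H : Type*} [NormedAddCommGroup H] [InnerProductSpace ℂ H] [CompleteSpace H]

/-- The function `φ(T)` for continuous `φ`. -/
def continuousFun (φ : ℝ → ℝ) (T : H →L[ℂ] H) : H →L[ℂ] H := cfc φ T

theorem norm_continuousFun_sub_le {T : H →L[ℂ] H} {K ε : ℝ} (hK : ‖T‖ ≤ K) (hε : 0 ≤ ε)
    {φ ψ : ℝ → ℝ} (hφ : Continuous φ) (hψ : Continuous ψ)
    (h : ∀ t ∈ Icc (-K) K, |φ t - ψ t| ≤ ε) :
    ‖continuousFun φ T - continuousFun ψ T‖ ≤ ε := by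
  rw [continuousFun, continuousFun, ← cfc_sub φ ψ T hφ.continuousOn hψ.continuousOn]
  refine norm_cfc_le hε fun t ht => h t (abs_le.1 ?_)
  have h1 := spectrum.norm_le_norm_mul_of_mem ht
  have h2 : ‖(1 : H →L[ℂ] H)‖ ≤ 1 := ContinuousLinearMap.norm_id_le
  calc |t| ≤ ‖T‖ * ‖(1 : H →L[ℂ] H)‖ := h1
    _ ≤ ‖T‖ * 1 := by gcongr
    _ ≤ K := by rwa [mul_one]

theorem continuousFun_polynomial {T : H →L[ℂ] H} (hT : IsSelfAdjoint T) (q : Polynomial ℝ) :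
    continuousFun q.eval T = Polynomial.aeval T (q.map (algebraMap ℝ ℂ)) := by
  rw [continuousFun, cfc_polynomial q T hT, ← Polynomial.aeval_map_algebraMap ℂ]

theorem IsSpectralMeasureAt.integral_eq {T : H →L[ℂ] H} {x : H} {m : Measure ℝ}
    (h : IsSpectralMeasureAt T x m) (g : BoundedContinuousFunction ℝ ℝ) :
    ∫ t, g t ∂m = (⟪x, continuousFun g T x⟫_ℂ).re := by
  rw [continuousFun, ← h.2 g, Complex.ofReal_re]

end ContinuousFunction

namespace DeloneSystem
variable {d : ℕ} {r R : ℝ} {Ω : DeloneSystem d r R}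

section Calculus

/-- Polynomials in `A` stay in the algebra `randomFamilies Ω`, hence are measurable. A uniform norm
bound `K` allows one sequence of Weierstrass polynomials on `[-K, K]` to serve all fibres. -/
theorem measurable_inner_continuousFun {A : Ω.OpFamily} (hA : A ∈ randomFamilies Ω)
    (hsa : ∀ ω, IsSelfAdjoint (A ω)) {g h : Ω.Section} (hg : Ω.MeasurableSection g)
    (hh : Ω.MeasurableSection h) {φ : ℝ → ℝ} (hφ : Continuous φ) :
    Measurable fun ω => ⟪g ω, continuousFun φ (A ω) (h ω)⟫_ℂ := by
  obtain ⟨K, hK⟩ := hA.2.2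
  choose p hp using fun n : ℕ => exists_polynomial_near_of_continuousOn (-K) K φ hφ.continuousOn
    (1 / ((n : ℝ) + 1)) (by positivity)
  have hpoly : ∀ (q : Polynomial ℝ) (ω : Ω.Pt), continuousFun q.eval (A ω) =
      (Polynomial.aeval (⟨A, hA⟩ : randomFamilies Ω) (q.map (algebraMap ℝ ℂ))).1 ω := by
    intro q ω
    let π : randomFamilies Ω →ₐ[ℂ] (Ell2 ω.1 →L[ℂ] Ell2 ω.1) :=
      (Pi.evalAlgHom ℂ (fun ω : Ω.Pt => Ell2 ω.1 →L[ℂ] Ell2 ω.1) ω).comp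
        (randomFamilies Ω).subtype.toAlgHom
    rw [continuousFun_polynomial (hsa ω)]
    exact Polynomial.aeval_algHom_apply π ⟨A, hA⟩ _
  refine measurable_of_tendsto_metrizable
    (f := fun n ω => ⟪g ω, continuousFun (p n).eval (A ω) (h ω)⟫_ℂ) (fun n => ?_) ?_
  · simp_rw [hpoly]
    exact (Polynomial.aeval (⟨A, hA⟩ : randomFamilies Ω) _).2.2.1 g h hg hh
  · rw [tendsto_pi_nhds]
    intro ω
    have h1 : Tendsto (fun n => continuousFun (p n).eval (A ω)) atTop (𝓝 (continuousFun φ (A ω))) := by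
      rw [tendsto_iff_norm_sub_tendsto_zero]
      refine squeeze_zero (fun _ => norm_nonneg _) (fun n => ?_)
        (tendsto_one_div_add_atTop_nhds_zero_nat (𝕜 := ℝ))
      exact norm_continuousFun_sub_le (hK ω) (by positivity) (p n).continuous hφ
        fun t ht => (hp n t ht).le
    exact tendsto_const_nhds.inner
      (((ContinuousLinearMap.apply ℂ (Ell2 ω.1) (h ω)).continuous.tendsto _).comp h1)

/-- Spectral measures along a measurable section form a measurable family. -/
theorem measurable_spectralMeasure {A : Ω.OpFamily} (hA : A ∈ randomFamilies Ω)
    (hsa : ∀ ω, IsSelfAdjoint (A ω)) {h : Ω.Section} (hh : Ω.MeasurableSection h)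
    {m : Ω.Pt → Measure ℝ} (hm : ∀ ω, IsSpectralMeasureAt (A ω) (h ω) (m ω)) : Measurable m := by
  have hfin : ∀ ω, IsFiniteMeasure (m ω) := fun ω => (hm ω).1
  -- The mass of a closed set is a limit of integrals of bounded continuous functions, which are
  -- matrix elements of continuous functions of `A_ω`. Closed sets form a π-system generating the
  -- Borel sets.
  have hclosed : ∀ s : Set ℝ, IsClosed s → Measurable fun ω => m ω s := fun s hs => by
    refine measurable_of_tendsto_metrizable (f := fun n ω => ∫⁻ t, hs.apprSeq n t ∂m ω)
      (fun n => ?_) (tendsto_pi_nhds.2 fun ω =>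
        HasOuterApproxClosed.tendsto_lintegral_apprSeq hs (m ω))
    let g : BoundedContinuousFunction ℝ ℝ :=
      ⟨⟨fun t => (hs.apprSeq n t : ℝ), NNReal.continuous_coe.comp (hs.apprSeq n).continuous⟩,
        (hs.apprSeq n).map_bounded'⟩
    have e : ∀ ω, ∫⁻ t, hs.apprSeq n t ∂m ω =
        ENNReal.ofReal (⟪h ω, continuousFun g (A ω) (h ω)⟫_ℂ).re := fun ω => by
      have h1 : ∫ t, g t ∂m ω = (∫⁻ t, hs.apprSeq n t ∂m ω).toReal :=
        (BoundedContinuousFunction.toReal_lintegral_coe_eq_integral _ _).symm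
      rw [← (hm ω).integral_eq g, h1,
        ENNReal.ofReal_toReal (BoundedContinuousFunction.lintegral_lt_top_of_nnreal _ _).ne]
    simp_rw [e]
    exact (Complex.measurable_re.comp (measurable_inner_continuousFun hA hsa hh hh
      g.continuous)).ennreal_ofReal
  refine Measurable.measure_of_isPiSystem (S := {s | IsClosed s}) ?_ isPiSystem_isClosed
    hclosed (hclosed univ isClosed_univ)
  rw [BorelSpace.measurable_eq (α := ℝ), borel_eq_generateFrom_isClosed]

theorem MeasurableSection.add {f g : Ω.Section} (hf : Ω.MeasurableSection f)
    (hg : Ω.MeasurableSection g) : Ω.MeasurableSection fun ω => f ω + g ω :=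
  Measurable.add hf hg

theorem MeasurableSection.const_smul {f : Ω.Section} (hf : Ω.MeasurableSection f) (c : ℂ) :
    Ω.MeasurableSection fun ω => c • f ω :=
  Measurable.const_mul hf c

theorem MeasurableSection.sub {f g : Ω.Section} (hf : Ω.MeasurableSection f)
    (hg : Ω.MeasurableSection g) : Ω.MeasurableSection fun ω => f ω - g ω :=
  Measurable.sub hf hg

/-- Bounded Borel functions of a selfadjoint family form a covariant, measurable, bounded
family. -/
theorem exists_borelFunction_family {A : Ω.OpFamily} (hA : A ∈ randomFamilies Ω)
    (hsa : ∀ ω, IsSelfAdjoint (A ω)) {F : ℝ → ℂ} (hF : Measurable F) {K : ℝ}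
    (hK : ∀ t, ‖F t‖ ≤ K) :
    ∃ C ∈ randomFamilies Ω, ∀ ω, IsBorelFunctionOf (A ω) F (C ω) := by
  choose C hCK hC using fun ω => exists_isBorelFunctionOf (hsa ω) hF hK
  refine ⟨C, ⟨fun t ω => ?_, ?_, 4 * K, hCK⟩, hC⟩
  · have h := (hC ω).conj (hsa ω) (shiftUnitary t ω.1)
    have e : A (t +ᵥ ω) = (shiftUnitary t ω.1).conjStarAlgEquiv (A ω) := hA.1 t ω
    have h' : IsBorelFunctionOf (A (t +ᵥ ω)) F ((shiftUnitary t ω.1).conjStarAlgEquiv (C ω)) := by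
      rw [e]
      exact h
    -- Covariance is forced: both operators are `F` of `A_{ω+t}`.
    exact (hC (t +ᵥ ω)).unique h'
  -- Diagonal matrix elements are integrals against a measurable family of spectral measures;
  -- polarization then yields all matrix elements.
  · have hq : ∀ h : Ω.Section, Ω.MeasurableSection h →
        Measurable fun ω => ⟪h ω, C ω (h ω)⟫_ℂ := fun h hh => by
      choose m hm _ using fun ω => exists_isSpectralMeasureAt (hsa ω) (h ω)
      simp_rw [fun ω => (hC ω).inner_eq (hm ω)]
      exact measurable_integral_of_bounded (measurable_spectralMeasure hA hsa hh hm)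
        (fun ω => (hm ω).1) hF hK
    intro f g hf hg
    simp_rw [fun ω => (polarization_inner (C ω) (f ω) (g ω)).symm]
    have hIg := hg.const_smul Complex.I
    exact ((((hq _ (hf.add hg)).sub (hq _ (hf.sub hg))).sub
      ((hq _ (hf.add hIg)).const_mul _)).add ((hq _ (hf.sub hIg)).const_mul _)).const_mul _

end Calculus

end DeloneSystem
end Delone

/-! ### Representatives in a quotient ring. -/

section QuotientRing
variable {S : Type*} [Ring S] (I : Ideal S)

theorem Ideal.Quotient.mk_out_add_out [I.IsTwoSided] (A B : S ⧸ I) :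
    Ideal.Quotient.mk I (Quotient.out (A + B)) =
      Ideal.Quotient.mk I (Quotient.out A + Quotient.out B) := by
  rw [map_add, Ideal.Quotient.mk_out, Ideal.Quotient.mk_out, Ideal.Quotient.mk_out]

theorem Ideal.Quotient.mk_out_mul_out [I.IsTwoSided] (A B : S ⧸ I) :
    Ideal.Quotient.mk I (Quotient.out (A * B)) =
      Ideal.Quotient.mk I (Quotient.out A * Quotient.out B) := by
  rw [map_mul, Ideal.Quotient.mk_out, Ideal.Quotient.mk_out, Ideal.Quotient.mk_out]

theorem Ideal.Quotient.mk_out_smul_out {k : Type*} [CommRing k] [Algebra k S]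
    [I.IsTwoSided] (c : k) (A : S ⧸ I) :
    Ideal.Quotient.mk I (Quotient.out (c • A)) = Ideal.Quotient.mk I (c • Quotient.out A) := by
  have h : Ideal.Quotient.mk I (c • Quotient.out A) = c • Ideal.Quotient.mk I (Quotient.out A) :=
    rfl
  rw [h, Ideal.Quotient.mk_out, Ideal.Quotient.mk_out]

end QuotientRing

/-! ### Positivity, supports and vanishing criteria. -/

namespace Delone

/-- Write `S = B*B`; then `⟨x, S x⟩ = ‖B x‖²`. -/
theorem apply_eq_zero_of_inner_eq_zero {H : Type*} [NormedAddCommGroup H] [InnerProductSpace ℂ H]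
    [CompleteSpace H] {S : H →L[ℂ] H} (hS : S.IsPositive) {x : H} (h : ⟪x, S x⟫_ℂ = 0) :
    S x = 0 := by
  obtain ⟨B, rfl⟩ := CStarAlgebra.nonneg_iff_eq_star_mul_self.1
    ((ContinuousLinearMap.nonneg_iff_isPositive S).2 hS)
  rw [mul_apply_eq_comp, ContinuousLinearMap.star_eq_adjoint,
    ContinuousLinearMap.adjoint_inner_right, inner_self_eq_zero] at h
  rw [mul_apply_eq_comp, h, map_zero]

/-- A measure whose null sets among basic open sets are those disjoint from a closed set `S` has
support `S`. -/
theorem support_eq_of_measure_eq_zero_iff {ρ : Measure ℝ} {S : Set ℝ} (hS : IsClosed S)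
    (h : ∀ U ∈ TopologicalSpace.countableBasis ℝ, ρ U = 0 ↔ Disjoint S U) : ρ.support = S := by
  have hb := TopologicalSpace.isBasis_countableBasis ℝ
  ext x
  rw [Measure.mem_support_iff_forall]
  constructor
  · intro hx
    by_contra hxS
    obtain ⟨U, hU, hxU, hUS⟩ := hb.mem_nhds_iff.1 (hS.isOpen_compl.mem_nhds hxS)
    have := (h U hU).2 (Set.disjoint_left.2 fun y hy hyU => hUS hyU hy)
    exact (hx U ((hb.isOpen hU).mem_nhds hxU)).ne' this
  · intro hx V hV
    obtain ⟨U, hU, hxU, hUV⟩ := hb.mem_nhds_iff.1 hV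
    refine lt_of_lt_of_le (pos_iff_ne_zero.2 fun h0 => ?_) (measure_mono hUV)
    exact Set.disjoint_left.1 ((h U hU).1 h0) hx hxU

/-- A normalized function which is positive exactly on the given ball. -/
theorem exists_isNormalized {d : ℕ} (c : Space d) {ε : ℝ} (hε : 0 < ε) :
    ∃ f : C_c(Space d, ℝ), IsNormalized f ∧ ∀ x, dist x c < ε → f x ≠ 0 := by
  let b : ContDiffBump c := ⟨ε / 2, ε, half_pos hε, half_lt_self hε⟩
  refine ⟨⟨⟨b.normed volume, b.continuous_normed⟩, b.hasCompactSupport_normed⟩,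
    ⟨fun x => b.nonneg_normed x, b.integral_normed⟩, fun x hx => ?_⟩
  have : x ∈ Function.support (b.normed volume) := by
    rw [b.support_normed_eq]
    exact hx
  exact this

open Classical in
-- The adjoint vanishes coordinatewise, since `(T* v)(x) = ⟨T δ_x, v⟩`; no density argument is
-- needed.
theorem eq_zero_of_apply_single {d : ℕ} {ω : ClosedSubset d} {T : Ell2 ω →L[ℂ] Ell2 ω}
    (h : ∀ x : ω, T (lp.single 2 x (1 : ℂ)) = 0) : T = 0 := by
  have h1 : ContinuousLinearMap.adjoint T = 0 := by
    ext v x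
    have h2 := ContinuousLinearMap.adjoint_inner_right T (lp.single 2 x (1 : ℂ)) v
    rw [h, inner_zero_left, lp.inner_single_left] at h2
    simpa using h2
  rw [← ContinuousLinearMap.adjoint_adjoint T, h1, map_zero]

namespace DeloneSystem
variable {d : ℕ} {r R : ℝ} {Ω : DeloneSystem d r R}

/-- Expresses vanishing by countably many conditions on measurable sections, so that the zero set of
a measurable family is measurable. -/
theorem eq_zero_iff_forall_inner_cellSection {ω : Ω.Pt} (T : Ell2 ω.1 →L[ℂ] Ell2 ω.1) :
    T = 0 ↔ ∀ m n : ℕ, ⟪(cellSection 1 m : Ω.Section) ω, T ((cellSection 1 n : Ω.Section) ω)⟫_ℂ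
      = 0 := by
  classical
  constructor
  · rintro rfl m n
    simp
  · intro h
    refine eq_zero_of_apply_single fun y => ?_
    ext x
    have := h (cell Ω x) (cell Ω y)
    rw [cellSection_cell, cellSection_cell, lp.inner_single_left] at this
    simpa using this

theorem measurableSet_eq_zero {C : Ω.OpFamily} (hC : MeasurableFamily C) :
    MeasurableSet {ω | C ω = 0} := by
  simp_rw [eq_zero_iff_forall_inner_cellSection, ofPred_forall]
  exact MeasurableSet.iInter fun m => MeasurableSet.iInter fun n =>
    hC _ _ (measurableSection_cellSection measurable_one m)
      (measurableSection_cellSection measurable_one n) (measurableSet_singleton 0)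

theorem Covariant.vadd_eq_zero_iff {C : Ω.OpFamily} (hC : Covariant C) (t : Space d) (ω : Ω.Pt) :
    C (t +ᵥ ω) = 0 ↔ C ω = 0 := by
  have e : C (t +ᵥ ω) = (shiftUnitary t ω.1).conjStarAlgEquiv (C ω) := hC t ω
  rw [e]
  exact EmbeddingLike.map_eq_zero_iff (f := (shiftUnitary t ω.1).conjStarAlgEquiv)

/-! ### The trace on `𝒩` and its properties. -/

namespace RandomOperator
variable {μ : Measure Ω.Pt}

theorem mk_out (A : RandomOperator Ω μ) :
    Ideal.Quotient.mk (nullIdeal Ω μ) (Quotient.out A) = A := Quotient.out_eq A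

theorem mk_out_add (A B : RandomOperator Ω μ) :
    Ideal.Quotient.mk (nullIdeal Ω μ) (Quotient.out (A + B)) =
      Ideal.Quotient.mk (nullIdeal Ω μ) (Quotient.out A + Quotient.out B) :=
  Ideal.Quotient.mk_out_add_out _ A B

theorem mk_out_mul (A B : RandomOperator Ω μ) :
    Ideal.Quotient.mk (nullIdeal Ω μ) (Quotient.out (A * B)) =
      Ideal.Quotient.mk (nullIdeal Ω μ) (Quotient.out A * Quotient.out B) :=
  Ideal.Quotient.mk_out_mul_out _ A B

theorem mk_out_smul (c : ℂ) (A : RandomOperator Ω μ) :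
    Ideal.Quotient.mk (nullIdeal Ω μ) (Quotient.out (c • A)) =
      Ideal.Quotient.mk (nullIdeal Ω μ) (c • Quotient.out A) :=
  Ideal.Quotient.mk_out_smul_out _ c A

theorem eq_of_fiber_eq {A B : RandomOperator Ω μ} (h : ∀ᵐ ω ∂μ, A.fiber ω = B.fiber ω) :
    A = B := by
  rw [← mk_out A, ← mk_out B]
  exact mk_eq_mk_iff.2 h

theorem fiber_zero : ∀ᵐ ω ∂μ, (0 : RandomOperator Ω μ).fiber ω = 0 :=
  fiber_mk (0 : randomFamilies Ω)

theorem eq_zero_iff {A : RandomOperator Ω μ} : A = 0 ↔ ∀ᵐ ω ∂μ, A.fiber ω = 0 := by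
  constructor
  · rintro rfl
    exact fiber_zero
  · intro h
    refine eq_of_fiber_eq ?_
    filter_upwards [h, fiber_zero (μ := μ)] with ω h1 h2
    rw [h1, h2]

variable [IsFiniteMeasure μ]

theorem traceIntegral_congr {A B : randomFamilies Ω}
    (h : Ideal.Quotient.mk (nullIdeal Ω μ) A = Ideal.Quotient.mk (nullIdeal Ω μ) B)
    {f : C_c(Space d, ℝ)} (hf : ∀ x, 0 ≤ f x) : traceIntegral μ hf A = traceIntegral μ hf B := by
  refine integral_congr_ae ?_
  filter_upwards [mk_eq_mk_iff.1 h] with ω hω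
  rw [hω]

/-- The trace `τ` of the algebra of random operators. -/
def trace (μ : Measure Ω.Pt) [IsFiniteMeasure μ] {f : C_c(Space d, ℝ)} (hf : ∀ x, 0 ≤ f x) :
    RandomOperator Ω μ →ₗ[ℂ] ℂ where
  toFun A := traceIntegral μ hf (Quotient.out A)
  map_add' A B := by
    rw [← LinearMap.map_add]
    exact traceIntegral_congr (mk_out_add A B) hf
  map_smul' c A := by
    rw [RingHom.id_apply, ← LinearMap.map_smul]
    exact traceIntegral_congr (mk_out_smul c A) hf

theorem trace_apply {f : C_c(Space d, ℝ)} (hf : ∀ x, 0 ≤ f x) (A : RandomOperator Ω μ) :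
    trace μ hf A = ∫ ω : Ω.Pt, tr (A.fiber ω ∘L mulOp f ω.1) ∂μ := rfl

theorem integrable_tr_fiber {f : C_c(Space d, ℝ)} (hf : ∀ x, 0 ≤ f x) (A : RandomOperator Ω μ) :
    Integrable (fun ω : Ω.Pt => tr (A.fiber ω ∘L mulOp f ω.1)) μ :=
  integrable_tr μ (Quotient.out A : randomFamilies Ω).2 hf

theorem trace_eq_sum (Ω : DeloneSystem d r R) {f : C_c(Space d, ℝ)} (hf : ∀ x, 0 ≤ f x) :
    ∃ n : ℕ, (∀ x, f x ≠ 0 → cell Ω x < n) ∧ ∀ (μ : Measure Ω.Pt) [IsFiniteMeasure μ]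
      (A : RandomOperator Ω μ), trace μ hf A =
      ∑ i ∈ Finset.range n, ∫ ω, ⟪(cellSection (sqrtFun f) i : Ω.Section) ω,
        A.fiber ω ((cellSection (sqrtFun f) i : Ω.Section) ω)⟫_ℂ ∂μ := by
  obtain ⟨n, hn0, hn⟩ := exists_tr_eq_sum Ω hf
  refine ⟨n, hn0, fun μ _ A => ?_⟩
  refine Eq.trans ?_ (integral_finsetSum _ fun i _ =>
    integrable_inner_cellSection μ (Quotient.out A : randomFamilies Ω).2 f i)
  rw [trace_apply]
  simp_rw [hn]

/-- The two-weight identity `τ_f(AB) = τ_g(BA)` with `B = 1`. -/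
theorem trace_eq_trace [VAddInvariantMeasure (Space d) Ω.Pt μ] {f g : C_c(Space d, ℝ)}
    (hf : IsNormalized f) (hg : IsNormalized g) (A : RandomOperator Ω μ) :
    trace μ hf.1 A = trace μ hg.1 A := by
  have h := traceIntegral_mul_comm μ (Quotient.out A) 1 hf hg
  rwa [mul_one, one_mul] at h

theorem trace_mul_comm [VAddInvariantMeasure (Space d) Ω.Pt μ] {f : C_c(Space d, ℝ)}
    (hf : IsNormalized f) (A B : RandomOperator Ω μ) :
    trace μ hf.1 (A * B) = trace μ hf.1 (B * A) := by
  have h : ∀ A B : RandomOperator Ω μ,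
      trace μ hf.1 (A * B) = traceIntegral μ hf.1 (Quotient.out A * Quotient.out B) := fun A B =>
    traceIntegral_congr (mk_out_mul A B) hf.1
  rw [h, h]
  exact traceIntegral_mul_comm μ _ _ hf hf

theorem exists_norm_trace_le {f : C_c(Space d, ℝ)} (hf : ∀ x, 0 ≤ f x) :
    ∃ K : ℝ, ∀ A : RandomOperator Ω μ, ‖trace μ hf A‖ ≤ K * A.opNorm := by
  obtain ⟨n, -, hn⟩ := trace_eq_sum Ω hf
  obtain ⟨L, hL⟩ := exists_norm_sqrtFun_le f
  have hL0 : 0 ≤ L := (norm_nonneg _).trans (hL 0)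
  -- The `+ 1` makes `c` positive, so one can divide by it and compare with every essential bound in
  -- the infimum defining `opNorm`.
  let c : ℝ := n * (L * L * μ.real univ) + 1
  have hc : 0 < c := by positivity
  refine ⟨c, fun A => ?_⟩
  rw [← div_le_iff₀' hc]
  refine le_csInf ?_ ?_
  · obtain ⟨K, hK⟩ := (Quotient.out A : randomFamilies Ω).2.2.2
    exact ⟨max K 0, le_max_right _ _, Eventually.of_forall fun ω =>
      (hK ω).trans (le_max_left _ _)⟩
  · rintro K ⟨hK0, hK⟩
    rw [div_le_iff₀' hc, hn]
    calc ‖∑ i ∈ Finset.range n, ∫ ω, ⟪(cellSection (sqrtFun f) i : Ω.Section) ω,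
          A.fiber ω ((cellSection (sqrtFun f) i : Ω.Section) ω)⟫_ℂ ∂μ‖
        ≤ ∑ i ∈ Finset.range n, (L * (K * L)) * μ.real univ := by
          refine (norm_sum_le _ _).trans (Finset.sum_le_sum fun i _ => ?_)
          refine norm_integral_le_of_norm_le_const ?_
          filter_upwards [hK] with ω hω
          have hi := norm_cellSection_le (Ω := Ω) hL i ω
          refine (norm_inner_le_norm _ _).trans (mul_le_mul hi ?_ (norm_nonneg _) hL0)
          exact ((A.fiber ω).le_opNorm _).trans (mul_le_mul hω hi (norm_nonneg _) hK0)
      _ ≤ c * K := by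
          rw [Finset.sum_const, Finset.card_range, nsmul_eq_mul]
          simp only [c]
          nlinarith

theorem continuous_trace {f : C_c(Space d, ℝ)} (hf : ∀ x, 0 ≤ f x) :
    Continuous[weakOperatorTopology Ω μ, inferInstance] (trace μ hf) := by
  obtain ⟨n, -, hn⟩ := trace_eq_sum Ω hf
  obtain ⟨L, hL⟩ := exists_norm_sqrtFun_le f
  let h : ℕ → L2Section Ω μ := fun i => ⟨cellSection (sqrtFun f) i,
    measurableSection_cellSection (measurable_sqrtFun f) i, by
      have hm : Ω.MeasurableSection (cellSection (sqrtFun f) i) :=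
        measurableSection_cellSection (measurable_sqrtFun f) i
      have e : (fun ω => ‖(cellSection (sqrtFun f) i : Ω.Section) ω‖ ^ 2) = fun ω =>
          (⟪(cellSection (sqrtFun f) i : Ω.Section) ω,
            (cellSection (sqrtFun f) i : Ω.Section) ω⟫_ℂ).re := by
        funext ω
        rw [inner_self_eq_norm_sq_to_K]
        norm_cast
      refine Integrable.of_bound (C := L ^ 2) ?_ (Eventually.of_forall fun ω => ?_)
      · rw [e]
        exact (Complex.measurable_re.comp (measurable_inner hm hm)).aestronglyMeasurable
      · rw [norm_pow, norm_norm]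
        exact pow_le_pow_left₀ (norm_nonneg _) (norm_cellSection_le hL i ω) 2⟩
  -- The trace is a finite sum of coordinates of the map inducing the weak operator topology.
  let Φ : (L2Section Ω μ × L2Section Ω μ → ℂ) → ℂ := fun a => ∑ i ∈ Finset.range n, a (h i, h i)
  have hΦ : Continuous Φ := continuous_finsetSum _ fun i _ => continuous_apply _
  have e : (trace μ hf : RandomOperator Ω μ → ℂ) = Φ ∘ fun A p =>
      ∫ ω, ⟪p.1.1 ω, A.fiber ω (p.2.1 ω)⟫_ℂ ∂μ := funext fun A => hn μ A
  rw [e]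
  exact @Continuous.comp _ _ _ (weakOperatorTopology Ω μ) _ _ _ _ hΦ continuous_induced_dom

open scoped ComplexOrder in
theorem trace_nonneg {f : C_c(Space d, ℝ)} (hf : ∀ x, 0 ≤ f x) {A : RandomOperator Ω μ}
    (hA : A.Nonneg) : 0 ≤ (trace μ hf A).re ∧ (trace μ hf A).im = 0 := by
  obtain ⟨n, -, hn⟩ := trace_eq_sum Ω hf
  have h : 0 ≤ trace μ hf A := by
    rw [hn]
    refine Finset.sum_nonneg fun i _ => integral_nonneg_of_ae ?_
    filter_upwards [hA] with ω hω
    exact hω.inner_nonneg_right _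
  exact ⟨(Complex.nonneg_iff.1 h).1, (Complex.nonneg_iff.1 h).2.symm⟩

open scoped ComplexOrder in
-- A vanishing sum of integrals of nonnegative functions forces `⟨h_i, A_ω h_i⟩ = 0` almost surely,
-- hence `A_ω h_i = 0` by positivity; where `f(x) ≠ 0` the factor `√f(x)` can be cancelled.
theorem fiber_apply_single_eq_zero {f : C_c(Space d, ℝ)} (hf : ∀ x, 0 ≤ f x)
    {A : RandomOperator Ω μ} (hA : A.Nonneg) (h : trace μ hf A = 0) :
    ∀ᵐ ω ∂μ, ∀ x : ω.1, f x ≠ 0 → A.fiber ω (cellSection 1 (cell Ω x) ω) = 0 := by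
  classical
  obtain ⟨n, hn0, hn⟩ := trace_eq_sum Ω hf
  rw [hn] at h
  have hnn : ∀ i, 0 ≤ᵐ[μ] fun ω => ⟪(cellSection (sqrtFun f) i : Ω.Section) ω,
      A.fiber ω ((cellSection (sqrtFun f) i : Ω.Section) ω)⟫_ℂ := fun i => by
    filter_upwards [hA] with ω hω
    exact hω.inner_nonneg_right _
  have h0 := (Finset.sum_eq_zero_iff_of_nonneg fun i _ => integral_nonneg_of_ae (hnn i)).1 h
  have h1 : ∀ i ∈ Finset.range n, ∀ᵐ ω ∂μ, ⟪(cellSection (sqrtFun f) i : Ω.Section) ω,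
      A.fiber ω ((cellSection (sqrtFun f) i : Ω.Section) ω)⟫_ℂ = 0 := fun i hi => by
    have hint := integrable_inner_cellSection μ (Quotient.out A : randomFamilies Ω).2 f i
    have h2 : ∫ ω, (⟪(cellSection (sqrtFun f) i : Ω.Section) ω,
      A.fiber ω ((cellSection (sqrtFun f) i : Ω.Section) ω)⟫_ℂ).re ∂μ = 0 := by
      have := integral_re hint
      exact this.trans (by
        have h3 := congrArg Complex.re (h0 i hi)
        exact h3)
    have h3 := (integral_eq_zero_iff_of_nonneg_ae
      ((hnn i).mono fun ω hω => (Complex.nonneg_iff.1 hω).1) hint.re).1 h2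
    filter_upwards [h3, hnn i] with ω h4 h5
    exact Complex.ext h4 (Complex.nonneg_iff.1 h5).2.symm
  filter_upwards [hA, (ae_ball_iff (Finset.range n).countable_toSet).2 h1] with ω hω h2 x hx
  have h3 := apply_eq_zero_of_inner_eq_zero hω (h2 _ (Finset.mem_range.2 (hn0 x hx)))
  have e : (cellSection (sqrtFun f) (cell Ω x) : Ω.Section) ω =
      sqrtFun f x • (cellSection 1 (cell Ω x) : Ω.Section) ω := by
    rw [cellSection_cell, cellSection_cell, ← lp.single_smul]
    simp
  rw [e, map_smul] at h3
  refine (smul_eq_zero.1 h3).resolve_left ?_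
  exact Complex.ofReal_ne_zero.2 ((Real.sqrt_ne_zero (hf x)).2 hx)

theorem eq_zero_of_trace_eq_zero [VAddInvariantMeasure (Space d) Ω.Pt μ] {f : C_c(Space d, ℝ)}
    (hf : IsNormalized f) {A : RandomOperator Ω μ} (hA : A.Nonneg) (h : trace μ hf.1 A = 0) :
    A = 0 := by
  classical
  -- Each `g n` is nonzero on the ball containing the `n`-th cell. Independence of the weight lets
  -- all of them compute the same zero trace, and together they reach every point of `ω`.
  choose g hg hg0 using fun n : ℕ => exists_isNormalized (center d n) (half_pos Ω.r_pos)
  have h1 : ∀ n, ∀ᵐ ω ∂μ, ∀ x : ω.1, g n x ≠ 0 → A.fiber ω (cellSection 1 (cell Ω x) ω) = 0 :=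
    fun n => fiber_apply_single_eq_zero (hg n).1 hA (by rw [trace_eq_trace (hg n) hf, h])
  refine eq_zero_iff.2 ?_
  filter_upwards [ae_all_iff.2 h1] with ω hω
  refine eq_zero_of_apply_single fun x => ?_
  have := hω (cell Ω x) x (hg0 _ _ (dist_center_cell_lt Ω x))
  rwa [cellSection_cell] at this

end RandomOperator

end DeloneSystem

end Delone

/-! ### The spectral measure `ρ_A` and its support. -/

namespace Delone

namespace DeloneSystem
variable {d : ℕ} {r R : ℝ} {Ω : DeloneSystem d r R}

namespace RandomOperator
variable {μ : Measure Ω.Pt}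

/-- A selfadjoint element has a representative all of whose fibres are selfadjoint. -/
theorem SelfAdjoint.exists_representative {A : RandomOperator Ω μ} (hA : A.SelfAdjoint) :
    ∃ T ∈ randomFamilies Ω, (∀ ω, IsSelfAdjoint (T ω)) ∧ ∀ᵐ ω ∂μ, A.fiber ω = T ω := by
  let a : randomFamilies Ω := Quotient.out A
  -- The real part of a representative is selfadjoint everywhere and agrees with it wherever it was
  -- selfadjoint.
  let T : randomFamilies Ω := (1 / 2 : ℂ) • (a + star a)
  have hT : ∀ ω, T.1 ω = (1 / 2 : ℂ) • (a.1 ω + star (a.1 ω)) := fun ω => rfl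
  refine ⟨T.1, T.2, fun ω => ?_, ?_⟩
  · rw [hT, isSelfAdjoint_iff, star_smul, star_add, star_star, add_comm]
    congr 1
    simp
  · filter_upwards [hA] with ω hω
    have h : star (a.1 ω) = a.1 ω := hω
    rw [hT, h, ← two_smul ℂ (a.1 ω), smul_smul]
    norm_num
    rfl

theorem IsFunctionOf.eq {A C C' : RandomOperator Ω μ} {F : ℝ → ℂ} (h : A.IsFunctionOf F C)
    (h' : A.IsFunctionOf F C') : C = C' := by
  refine eq_of_fiber_eq ?_
  filter_upwards [h, h'] with ω h1 h2
  exact h1.unique h2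

theorem isFunctionOf_mk {A : RandomOperator Ω μ} {T C : Ω.OpFamily}
    (hT : ∀ᵐ ω ∂μ, A.fiber ω = T ω) (hC : C ∈ randomFamilies Ω) {F : ℝ → ℂ}
    (h : ∀ ω, IsBorelFunctionOf (T ω) F (C ω)) :
    A.IsFunctionOf F (Ideal.Quotient.mk (nullIdeal Ω μ) ⟨C, hC⟩) := by
  have hmk := fiber_mk (μ := μ) ⟨C, hC⟩
  filter_upwards [hT, hmk] with ω h1 h2
  rw [h1, h2]
  exact h ω

theorem SelfAdjoint.existsUnique_isFunctionOf {A : RandomOperator Ω μ} (hA : A.SelfAdjoint)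
    {F : ℝ → ℂ} (hF : Measurable F) (hFb : ∃ K : ℝ, ∀ t, ‖F t‖ ≤ K) :
    ∃! C, A.IsFunctionOf F C := by
  obtain ⟨K, hK⟩ := hFb
  obtain ⟨T, hTmem, hTsa, hT⟩ := hA.exists_representative
  obtain ⟨C, hCmem, hC⟩ := exists_borelFunction_family hTmem hTsa hF hK
  exact ⟨_, isFunctionOf_mk hT hCmem hC, fun C' hC' => hC'.eq (isFunctionOf_mk hT hCmem hC)⟩

theorem norm_indicator_one_le (B : Set ℝ) (t : ℝ) :
    ‖B.indicator (fun _ => (1 : ℂ)) t‖ ≤ 1 := by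
  by_cases h : t ∈ B <;> simp [h]

theorem measurable_indicator_one {B : Set ℝ} (hB : MeasurableSet B) :
    Measurable (B.indicator fun _ => (1 : ℂ)) := measurable_const.indicator hB

/-- In the ergodic case the spectrum almost surely meets a given open set or almost surely does
not. -/
theorem SelfAdjoint.ae_disjoint_or {A : RandomOperator Ω μ} (hA : A.SelfAdjoint)
    (hμ : ErgodicVAdd (Space d) Ω.Pt μ) {U : Set ℝ} (hU : IsOpen U) :
    (∀ᵐ ω ∂μ, Disjoint (spectrum ℝ (A.fiber ω)) U) ∨
      ∀ᵐ ω ∂μ, ¬ Disjoint (spectrum ℝ (A.fiber ω)) U := by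
  obtain ⟨T, hTmem, hTsa, hT⟩ := hA.exists_representative
  obtain ⟨C, hCmem, hC⟩ := exists_borelFunction_family hTmem hTsa
    (measurable_indicator_one hU.measurableSet) (norm_indicator_one_le U)
  have h : ∀ᵐ ω ∂μ, (C ω = 0 ↔ Disjoint (spectrum ℝ (A.fiber ω)) U) := by
    filter_upwards [hT] with ω hω
    rw [hω]
    exact eq_zero_iff_disjoint_spectrum (hTsa ω) hU (hC ω)
  -- By covariance the set where the spectral projection of `U` vanishes is translation invariant,
  -- so ergodicity makes it null or conull.
  have hconst := hμ.aeconst_of_forall_preimage_vadd_ae_eq (measurableSet_eq_zero hCmem.2.1)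
    fun t => Eventually.of_forall fun ω => propext (hCmem.1.vadd_eq_zero_iff t ω)
  rcases eventuallyConst_set.1 hconst with h1 | h1
  · exact Or.inl (by filter_upwards [h, h1] with ω h2 h3 using h2.1 h3)
  · exact Or.inr (by filter_upwards [h, h1] with ω h2 h3 using fun h4 => h3 (h2.2 h4))

theorem isClosed_spectrum_fiber (A : RandomOperator Ω μ) (ω : Ω.Pt) :
    IsClosed (spectrum ℝ (A.fiber ω)) :=
  spectrum.isClosed _

variable [IsFiniteMeasure μ]

/-- The spectral measure `ρ_A`, as the measure representing `F ↦ τ(F(A))`. -/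
theorem SelfAdjoint.exists_measure {A : RandomOperator Ω μ} (hA : A.SelfAdjoint)
    {f : C_c(Space d, ℝ)} (hf : ∀ x, 0 ≤ f x) :
    ∃ ρ : Measure ℝ, IsFiniteMeasure ρ ∧ ∀ F : ℝ → ℂ, Measurable F → (∃ K : ℝ, ∀ t, ‖F t‖ ≤ K) →
      ∀ C, A.IsFunctionOf F C → trace μ hf C = ∫ t, F t ∂ρ := by
  obtain ⟨T, hTmem, hTsa, hT⟩ := hA.exists_representative
  obtain ⟨n, -, hn⟩ := trace_eq_sum Ω hf
  obtain ⟨L, hL⟩ := exists_norm_sqrtFun_le f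
  choose m hm _ using fun (i : ℕ) (ω : Ω.Pt) =>
    exists_isSpectralMeasureAt (hTsa ω) ((cellSection (sqrtFun f) i : Ω.Section) ω)
  have hmm : ∀ i, Measurable (m i) := fun i => measurable_spectralMeasure hTmem hTsa
    (measurableSection_cellSection (measurable_sqrtFun f) i) (hm i)
  have hmC : ∀ i ω, m i ω univ ≤ ENNReal.ofReal (L ^ 2) := fun i ω => by
    have := (hm i ω).1
    rw [← ofReal_measureReal, (hm i ω).measureReal_univ (hTsa ω)]
    exact ENNReal.ofReal_le_ofReal
      (pow_le_pow_left₀ (norm_nonneg _) (norm_cellSection_le hL i ω) 2)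
  have hbind : ∀ i, IsFiniteMeasure (μ.bind (m i)) := fun i =>
    (integral_bind_of_bounded μ (hmm i) ENNReal.ofReal_ne_top (hmC i)
      (measurable_const (a := (0 : ℂ))) (K := 0) (by simp)).1
  -- Each term `∫ ⟨h_i, F(A_ω) h_i⟩ dμ` of the trace is the integral of `F` against the `μ`-mixture
  -- of the spectral measures at `h_i`.
  refine ⟨∑ i ∈ Finset.range n, μ.bind (m i), inferInstance, ?_⟩
  rintro F hF ⟨K, hK⟩ C hC
  rw [hn, integral_finsetSum_measure fun i _ =>
    Integrable.of_bound hF.aestronglyMeasurable K (Eventually.of_forall hK)]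
  refine Finset.sum_congr rfl fun i _ => ?_
  rw [(integral_bind_of_bounded μ (hmm i) ENNReal.ofReal_ne_top (hmC i) hF hK).2]
  refine integral_congr_ae ?_
  filter_upwards [hC, hT] with ω h1 h2
  rw [h2] at h1
  exact h1.inner_eq (hm i ω)

variable [VAddInvariantMeasure (Space d) Ω.Pt μ]

/-- Since `χ_B(A) ≥ 0`, faithfulness of the trace makes `ρ` detect exactly the vanishing spectral
projections. -/
theorem trace_indicator {A : RandomOperator Ω μ} {f : C_c(Space d, ℝ)} (hf : IsNormalized f)
    {ρ : Measure ℝ} [IsFiniteMeasure ρ]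
    (hρ : ∀ F : ℝ → ℂ, Measurable F → (∃ K : ℝ, ∀ t, ‖F t‖ ≤ K) →
      ∀ C, A.IsFunctionOf F C → trace μ hf.1 C = ∫ t, F t ∂ρ)
    {B : Set ℝ} (hB : MeasurableSet B) {C : RandomOperator Ω μ}
    (hC : A.IsFunctionOf (B.indicator fun _ => 1) C) :
    trace μ hf.1 C = (ρ.real B : ℂ) ∧ (ρ B = 0 ↔ C = 0) := by
  have h1 : trace μ hf.1 C = (ρ.real B : ℂ) := by
    rw [hρ _ (measurable_indicator_one hB) ⟨1, norm_indicator_one_le B⟩ C hC,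
      integral_indicator_const _ hB]
    simp
  have hpos : C.Nonneg := hC.mono fun ω hω => isPositive_of_indicator hB hω
  refine ⟨h1, fun h0 => ?_, fun h0 => ?_⟩
  · refine eq_zero_of_trace_eq_zero hf hpos ?_
    rw [h1, measureReal_def, h0]
    simp
  · rw [h0, map_zero] at h1
    have h2 : ρ.real B = 0 := by exact_mod_cast h1.symm
    exact (measureReal_eq_zero_iff).1 h2

theorem SelfAdjoint.measure_isOpen_eq_zero_iff {A : RandomOperator Ω μ} (hA : A.SelfAdjoint)
    {f : C_c(Space d, ℝ)} (hf : IsNormalized f) {ρ : Measure ℝ} [IsFiniteMeasure ρ]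
    (hρ : ∀ F : ℝ → ℂ, Measurable F → (∃ K : ℝ, ∀ t, ‖F t‖ ≤ K) →
      ∀ C, A.IsFunctionOf F C → trace μ hf.1 C = ∫ t, F t ∂ρ) {U : Set ℝ} (hU : IsOpen U) :
    ρ U = 0 ↔ ∀ᵐ ω ∂μ, Disjoint (spectrum ℝ (A.fiber ω)) U := by
  obtain ⟨C, hC, -⟩ := hA.existsUnique_isFunctionOf (measurable_indicator_one hU.measurableSet)
    ⟨1, norm_indicator_one_le U⟩
  rw [(trace_indicator hf hρ hU.measurableSet hC).2, eq_zero_iff]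
  refine eventually_congr ?_
  filter_upwards [hA, hC] with ω h1 h2
  exact eq_zero_iff_disjoint_spectrum h1 hU h2

theorem SelfAdjoint.support_eq {A : RandomOperator Ω μ} (hA : A.SelfAdjoint)
    {f : C_c(Space d, ℝ)} (hf : IsNormalized f) {ρ : Measure ℝ} [IsFiniteMeasure ρ]
    (hρ : ∀ F : ℝ → ℂ, Measurable F → (∃ K : ℝ, ∀ t, ‖F t‖ ≤ K) →
      ∀ C, A.IsFunctionOf F C → trace μ hf.1 C = ∫ t, F t ∂ρ) {S : Set ℝ} (hμ : μ ≠ 0)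
    (hS : ∀ᵐ ω ∂μ, spectrum ℝ (A.fiber ω) = S) : ρ.support = S := by
  -- As `μ ≠ 0`, some fibre has spectrum `S`. This makes `S` closed and lets almost sure statements
  -- about `S` be evaluated.
  have : (ae μ).NeBot := ae_neBot.2 hμ
  obtain ⟨ω₀, h₀⟩ := hS.exists
  refine support_eq_of_measure_eq_zero_iff (h₀ ▸ isClosed_spectrum_fiber A ω₀) fun U hU => ?_
  rw [hA.measure_isOpen_eq_zero_iff hf hρ
    ((TopologicalSpace.isBasis_countableBasis ℝ).isOpen hU)]
  constructor
  · intro h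
    obtain ⟨ω, h1, h2⟩ := (h.and hS).exists
    rwa [h2] at h1
  · intro h
    filter_upwards [hS] with ω hω
    rwa [hω]

/-- For a basic open `U` with `ρ U ≠ 0`, the dichotomy shows that almost every spectrum meets `U`.
Since the basis is countable, almost every single fibre satisfies the support criterion for all `U`
at once. -/
theorem SelfAdjoint.ae_spectrum_eq {A : RandomOperator Ω μ} (hA : A.SelfAdjoint)
    {f : C_c(Space d, ℝ)} (hf : IsNormalized f) {ρ : Measure ℝ} [IsFiniteMeasure ρ]
    (hρ : ∀ F : ℝ → ℂ, Measurable F → (∃ K : ℝ, ∀ t, ‖F t‖ ≤ K) →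
      ∀ C, A.IsFunctionOf F C → trace μ hf.1 C = ∫ t, F t ∂ρ)
    (hμ : ErgodicVAdd (Space d) Ω.Pt μ) :
    ∀ᵐ ω ∂μ, spectrum ℝ (A.fiber ω) = ρ.support := by
  have h : ∀ U ∈ TopologicalSpace.countableBasis ℝ,
      ∀ᵐ ω ∂μ, (ρ U = 0 ↔ Disjoint (spectrum ℝ (A.fiber ω)) U) := fun U hU => by
    have hUo := (TopologicalSpace.isBasis_countableBasis ℝ).isOpen hU
    have hiff := hA.measure_isOpen_eq_zero_iff hf hρ hUo
    by_cases h0 : ρ U = 0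
    · filter_upwards [hiff.1 h0] with ω hω using iff_of_true h0 hω
    · have h1 := (hA.ae_disjoint_or hμ hUo).resolve_left fun h2 => h0 (hiff.2 h2)
      filter_upwards [h1] with ω hω using iff_of_false h0 hω
  filter_upwards [(ae_ball_iff (TopologicalSpace.countable_countableBasis ℝ)).2 h] with ω hω
  exact (support_eq_of_measure_eq_zero_iff (isClosed_spectrum_fiber A ω) hω).symm

end RandomOperator

end DeloneSystem
end Delone
end

theorem mainTheorem8 {d : ℕ} {r R : ℝ} (Ω : Delone.DeloneSystem d r R)
    (μ : Measure Ω.Pt) [IsFiniteMeasure μ] [VAddInvariantMeasure (Delone.Space d) Ω.Pt μ] :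
    ∃ τ : Delone.DeloneSystem.RandomOperator Ω μ →ₗ[ℂ] ℂ,
      -- for every normalized `f` the trace formula makes sense and defines the same `τ`
      (∀ f : C_c(Delone.Space d, ℝ), Delone.IsNormalized f →
        ∀ A : Delone.DeloneSystem.RandomOperator Ω μ,
          Integrable (fun ω : Ω.Pt => Delone.tr (A.fiber ω ∘L Delone.mulOp f ω.1)) μ ∧
          τ A = ∫ ω : Ω.Pt, Delone.tr (A.fiber ω ∘L Delone.mulOp f ω.1) ∂μ) ∧
      -- continuity, in the norm of `𝒩` and in the weak operator topology
      (∃ K : ℝ, ∀ A : Delone.DeloneSystem.RandomOperator Ω μ, ‖τ A‖ ≤ K * A.opNorm) ∧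
      Continuous[Delone.DeloneSystem.weakOperatorTopology Ω μ, inferInstance] τ ∧
      -- nonnegativity and faithfulness
      (∀ A : Delone.DeloneSystem.RandomOperator Ω μ, A.Nonneg →
        0 ≤ (τ A).re ∧ (τ A).im = 0 ∧ (τ A = 0 → A = 0)) ∧
      -- trace property
      (∀ A B : Delone.DeloneSystem.RandomOperator Ω μ, τ (A * B) = τ (B * A)) ∧
      -- the measure `ρ_A`
      ∀ A : Delone.DeloneSystem.RandomOperator Ω μ, A.SelfAdjoint →
        (∀ F : ℝ → ℂ, Measurable F → (∃ K : ℝ, ∀ t, ‖F t‖ ≤ K) → ∃! C, A.IsFunctionOf F C) ∧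
        ∃ ρ : Measure ℝ, IsFiniteMeasure ρ ∧
          (∀ B : Set ℝ, MeasurableSet B → ∀ C, A.IsFunctionOf (B.indicator fun _ => 1) C →
            τ C = (ρ.real B : ℂ) ∧ (ρ B = 0 ↔ C = 0)) ∧
          (∀ F : ℝ → ℂ, Measurable F → (∃ K : ℝ, ∀ t, ‖F t‖ ≤ K) → ∀ C, A.IsFunctionOf F C →
            τ C = ∫ t, F t ∂ρ) ∧
          (∀ S : Set ℝ, μ ≠ 0 → (∀ᵐ ω ∂μ, spectrum ℝ (A.fiber ω) = S) → ρ.support = S) ∧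
          (ErgodicVAdd (Delone.Space d) Ω.Pt μ →
            ∀ᵐ ω ∂μ, spectrum ℝ (A.fiber ω) = ρ.support) := by
  -- Any normalized weight may define `τ`; a bump function at the origin is taken.
  have hf := (Delone.exists_isNormalized (0 : Delone.Space d) one_pos).choose_spec.1
  refine ⟨Delone.DeloneSystem.RandomOperator.trace μ hf.1, ?_, ?_, ?_, ?_, ?_, ?_⟩
  · intro g hg A
    refine ⟨Delone.DeloneSystem.RandomOperator.integrable_tr_fiber hg.1 A, ?_⟩
    rw [Delone.DeloneSystem.RandomOperator.trace_eq_trace hf hg A]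
    exact Delone.DeloneSystem.RandomOperator.trace_apply hg.1 A
  · exact Delone.DeloneSystem.RandomOperator.exists_norm_trace_le hf.1
  · exact Delone.DeloneSystem.RandomOperator.continuous_trace hf.1
  · intro A hA
    obtain ⟨hre, him⟩ := Delone.DeloneSystem.RandomOperator.trace_nonneg hf.1 hA
    exact ⟨hre, him, Delone.DeloneSystem.RandomOperator.eq_zero_of_trace_eq_zero hf hA⟩
  · exact Delone.DeloneSystem.RandomOperator.trace_mul_comm hf
  · intro A hA
    refine ⟨fun F hF hFb => hA.existsUnique_isFunctionOf hF hFb, ?_⟩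
    refine (hA.exists_measure hf.1).imp fun ρ h => ?_
    have := h.1
    exact ⟨h.1, fun B hB C hC =>
        Delone.DeloneSystem.RandomOperator.trace_indicator hf h.2 hB hC, h.2,
      fun S hμ hS => hA.support_eq hf h.2 hμ hS, fun hμ => hA.ae_spectrum_eq hf h.2 hμ⟩
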